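/- \textbf{Setting.} Let $A\subset\mathbb R$ be a measurable set with $A=-A$ (bounded or unbounded), and write $dx$ for a reference measure on $\mathbb R$ invariant under $x\mapsto -x$ (Lebesgue measure for continuous outcomes, counting measure for discrete ones). A function $f:A\times\mathbb R\to[0,\infty)$ is \emph{valid} if $\int_A f(x;y)\,dx=1$ for all $y$; $f(x;y)=f(-x;-y)$; for every $x\in A$ with $x<0$ the function $y\mapsto f(x;y)$ is nonincreasing and tends to $0$ as $y\to\infty$; and $\sup_{y\in\mathbb R} f(x;y)<\infty$ for each fixed $x\in A$. It is \emph{strictly log-concave} in $y$ if $f>0$, $\log f(x;\cdot)$ is twice differentiable, and $\partial_y^2\log f(x;y)<0$ for all $x\in A$, $y\in\mathbb R$. Put $g(x;y)=\partial_y\log f(x;y)$ and $g_2=\partial_y g$, and let $X_y$ be a random variable with density $f(\cdot;y)$. Fix an integer $T\ge1$. For each $n$ let $p_n\in[0,1]$ and let $\mathbf u=\mathbf u^{(n)}\in\mathbb R^n$ be the true score vector, with $u_1=0$; assume that for some constant $c>1$, $p_n\ge c\,n^{-1}\log n$ for all large $n$. For $1\le i<j\le n$, the pair $(i,j)$ is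 compared $n_{ij}\sim\mathrm{Bin}(T,p_n)$ times, with outcomes $X_{ij}^{(t)}$, $t\le n_{ij}$, of density $f(\cdot;u_i-u_j)$; for each $n$ all the counts and outcomes are independent, and the data for all $n$ are defined on one probability space. The MLE $\hat{\mathbf u}$ is the maximizer of \[ l(\mathbf v)=\sum_{1\le i<j\le n}\ \sum_{t\le n_{ij}}\log f\big(X_{ij}^{(t)};v_i-v_j\big)\qquad\text{over } \{\mathbf v\in\mathbb R^n: v_1=0\}. \] Let $M_n=\max_{i,j}|u_i-u_j|$ and \[ C_n^{(1)}=\int_{A\cap[0,\infty)}f(x;M_n)\,dx,\qquad C_n^{(3)}=\sup_{x\in A,\,|y|\le M_n+1}|g_2(x;y)|,\qquad C_n^{(4)}=\inf_{x\in A,\,|y|\le M_n+1}|g_2(x;y)|. \] \textbf{Theorem (uniform consistency of the MLE, general case).} Suppose that $f$ is valid and strictly log-concave in $y$, and that there are finite constants $C_n^{(5)}\ge 0$ with \[ \sup_{|y|\le M_n}\|g(X_y;y)\|_{\psi_2}\le C_n^{(5)},\qquad \|Z\|_{\psi_2}=\inf\{t>0:\mathbb E\,e^{Z^2/t^2}\le2\}.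 \] Suppose that, as $n\to\infty$, \[ \Delta_n:=\frac{C_n^{(3)}C_n^{(5)}}{(C_n^{(4)})^2}\sqrt{\frac{\log n}{np_n}}\;\frac{\log n}{\log(np_n)}\to0 \qquad\text{and}\qquad \frac{\log n}{np_n\,|\log C_n^{(1)}|}\to0, \] where $\Delta_n=\infty$ if $C_n^{(3)}=\infty$ or $C_n^{(4)}=0$. Then there is a constant $K$ independent of $n$ such that, for all sufficiently large $n$, with probability at least $1-14n^{-2}$ the MLE $\hat{\mathbf u}$ uniquely exists and \[ \|\hat{\mathbf u}-\mathbf u\|_\infty\le K\,\Delta_n. \] In particular, $\hat{\mathbf u}$ is a uniformly consistent estimator of $\mathbf u$: almost surely, $\hat{\mathbf u}$ uniquely exists for all but finitely many $n$ and $\|\hat{\mathbf u}-\mathbf u\|_\infty\to0$. -/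

import Mathlib

open MeasureTheory ProbabilityTheory Filter Topology
open scoped ENNReal NNReal

noncomputable section

namespace PairwiseComparison

/-- A valid link function `f` on `A × ℝ`. Densities are taken with respect to a reflection-invariant
reference measure `ν` on `ℝ` (Lebesgue measure for continuous outcomes, counting measure for
discrete ones). Only the values `f x y` with `x ∈ A` matter. -/
structure IsValid (ν : Measure ℝ) (A : Set ℝ) (f : ℝ → ℝ → ℝ) : Prop where
  measurableSet : MeasurableSet A
  neg_mem : ∀ x ∈ A, -x ∈ A
  map_neg : ν.map (fun x => -x) = ν
  nonneg : ∀ x ∈ A, ∀ y, 0 ≤ f x y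
  integral_eq_one : ∀ y, ∫ x in A, f x y ∂ν = 1
  even : ∀ x ∈ A, ∀ y, f x y = f (-x) (-y)
  antitone : ∀ x ∈ A, x < 0 → Antitone (f x)
  tendsto_zero : ∀ x ∈ A, x < 0 → Tendsto (f x) atTop (𝓝 0)
  bddAbove : ∀ x ∈ A, BddAbove (Set.range (f x))

/-- The score `g(x; y) = ∂/∂y log f(x; y)`. -/
def score (f : ℝ → ℝ → ℝ) (x y : ℝ) : ℝ := deriv (fun z => Real.log (f x z)) y

/-- The derivative `g₂(x; y) = ∂/∂y g(x; y)` of the score. -/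
def scoreDeriv (f : ℝ → ℝ → ℝ) (x y : ℝ) : ℝ := deriv (score f x) y

/-- `f` is positive, `log f(x; ·)` is twice differentiable, and its second derivative is negative. -/
structure StrictlyLogConcave (A : Set ℝ) (f : ℝ → ℝ → ℝ) : Prop where
  pos : ∀ x ∈ A, ∀ y, 0 < f x y
  differentiable_log : ∀ x ∈ A, Differentiable ℝ (fun y => Real.log (f x y))
  differentiable_score : ∀ x ∈ A, Differentiable ℝ (score f x)
  scoreDeriv_neg : ∀ x ∈ A, ∀ y, scoreDeriv f x y < 0

/-- The law of the outcome `X_y` of a comparison with relative score `y`. -/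
def outcomeLaw (ν : Measure ℝ) (A : Set ℝ) (f : ℝ → ℝ → ℝ) (y : ℝ) : Measure ℝ :=
  (ν.restrict A).withDensity (fun x => ENNReal.ofReal (f x y))

/-- The `ψ₂`-norm of `h(X)` when `X` has law `Q`; it is `∞` when `h(X)` is not sub-Gaussian. -/
def psi2Norm (Q : Measure ℝ) (h : ℝ → ℝ) : ℝ≥0∞ :=
  ⨅ (t : ℝ) (_ : 0 < t) (_ : ∫⁻ x, ENNReal.ofReal (Real.exp (h x ^ 2 / t ^ 2)) ∂Q ≤ 2),
    ENNReal.ofReal t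

/-- The dynamic range `M = max_{i,j} |u_i - u_j|`. -/
def dynamicRange {n : ℕ} (u : Fin n → ℝ) : ℝ := ⨆ i, ⨆ j, |u i - u j|

/-- The global discrepancy `C⁽¹⁾`, at dynamic range `M`. -/
def C1 (ν : Measure ℝ) (A : Set ℝ) (f : ℝ → ℝ → ℝ) (M : ℝ) : ℝ :=
  ∫ x in A ∩ Set.Ici 0, f x M ∂ν

/-- `C⁽³⁾ = sup |g₂(x; y)|` over `x ∈ A`, `|y| ≤ M + 1`, possibly infinite. -/
def C3 (A : Set ℝ) (f : ℝ → ℝ → ℝ) (M : ℝ) : ℝ≥0∞ :=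
  ⨆ x ∈ A, ⨆ (y : ℝ) (_ : |y| ≤ M + 1), ENNReal.ofReal |scoreDeriv f x y|

/-- `C⁽⁴⁾ = inf |g₂(x; y)|` over `x ∈ A`, `|y| ≤ M + 1`. -/
def C4 (A : Set ℝ) (f : ℝ → ℝ → ℝ) (M : ℝ) : ℝ≥0∞ :=
  ⨅ x ∈ A, ⨅ (y : ℝ) (_ : |y| ≤ M + 1), ENNReal.ofReal |scoreDeriv f x y|

/-- The rate `Δ`, for `n` subjects, dynamic range `M`, comparison rate `p` and sub-Gaussian
constant `c5`. It is computed in `[0, ∞]`. -/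
def Delta (A : Set ℝ) (f : ℝ → ℝ → ℝ) (n : ℕ) (M p : ℝ) (c5 : ℝ≥0) : ℝ≥0∞ :=
  C3 A f M * c5 / C4 A f M ^ 2 *
    ENNReal.ofReal (√(Real.log n / (n * p)) * (Real.log n / Real.log (n * p)))

/-- The unordered pairs of distinct subjects, written as `(i, j)` with `i < j`. -/
abbrev Pair (n : ℕ) : Type := {e : Fin n × Fin n // e.1 < e.2}

/-- The comparison data of `n` subjects with latent scores `u`: each pair `e = (i, j)`, `i < j`, is
compared `N e ∼ Bin(T, p)` times, the outcome of its comparison number `t` is `X e t`, with density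
`f(·; u_i - u_j)`, and all these variables are independent. The outcomes `X e t` with `t < N e`
are the observed ones. -/
structure IsComparisonData {Ω : Type*} [MeasurableSpace Ω] (P : Measure Ω)
    (ν : Measure ℝ) (A : Set ℝ) (f : ℝ → ℝ → ℝ) (T : ℕ) (p : ℝ) {n : ℕ} (u : Fin n → ℝ)
    (N : Pair n → Ω → ℕ) (X : Pair n → Fin T → Ω → ℝ) : Prop where
  measurable_count : ∀ e, Measurable (N e)
  measurable_outcome : ∀ e t, Measurable (X e t)
  count_law : ∀ e k, P {ω | N e ω = k} =
    ENNReal.ofReal ((T.choose k : ℝ) * p ^ k * (1 - p) ^ (T - k))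
  outcome_law : ∀ e t, P.map (X e t) = outcomeLaw ν A f (u e.1.1 - u e.1.2)
  indep : iIndepFun (fun (k : Pair n × Option (Fin T)) (ω : Ω) =>
    k.2.elim (N k.1 ω : ℝ) (fun t => X k.1 t ω)) P

/-- The conditional log-likelihood of `v`, given the numbers `N e` of comparisons and the outcomes
`X e t`, `t < N e`. -/
def logLikelihood (f : ℝ → ℝ → ℝ) {T n : ℕ} (N : Pair n → ℕ) (X : Pair n → Fin T → ℝ)
    (v : Fin n → ℝ) : ℝ :=
  ∑ e : Pair n, ∑ t : Fin T with t.val < N e, Real.log (f (X e t) (v e.1.1 - v e.1.2))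

/-- The parameter space: the score of the first subject is `0`. -/
def paramSpace (n : ℕ) : Set (Fin n → ℝ) := {v | ∀ i : Fin n, (i : ℕ) = 0 → v i = 0}

/-- `v` is a maximum likelihood estimator: it maximizes `l` over the parameter space. -/
def IsMLE (f : ℝ → ℝ → ℝ) {T n : ℕ} (N : Pair n → ℕ) (X : Pair n → Fin T → ℝ)
    (v : Fin n → ℝ) : Prop :=
  v ∈ paramSpace n ∧ IsMaxOn (logLikelihood f N X) (paramSpace n) v

/-- `v` is the unique maximum likelihood estimator. -/
def IsUniqueMLE (f : ℝ → ℝ → ℝ) {T n : ℕ} (N : Pair n → ℕ) (X : Pair n → Fin T → ℝ)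
    (v : Fin n → ℝ) : Prop :=
  IsMLE f N X v ∧ ∀ w, IsMLE f N X w → w = v

end PairwiseComparison

end

open PairwiseComparison

/-!
Maximize the log-likelihood only over those `v` for which `v - u` has oscillation at most `1`, where
the curvature of each summand is at least `C⁽⁴⁾`. If `v` is such a maximizer, testing its optimality
against the upper level sets of `v - u` bounds the decrease of `v - u` across their boundaries by
the score noise. The comparison graph expands with high probability, so lowering the level by a
small `δ` multiplies the size of the upper level set by about `n p / log n`, until it holds half of
the subjects after `O(log n / log (n p))` steps. The same holds for lower level sets, so the two
halves meet and `v - u` has small oscillation. The maximizer is then interior to the localized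
domain, and by concavity and connectivity it is the unique global one; hence no condition on the
global discrepancy enters. Chernoff bounds control the noise and the expansion, and Borel–Cantelli
gives the almost sure statement.
-/

noncomputable section

namespace PairwiseComparison

section LinkFunction

variable {ν : Measure ℝ} {A : Set ℝ} {f : ℝ → ℝ → ℝ}

/-- `f(·; y)`, `y ∈ ℝ`, is a family of probability densities on `A` with respect to `ν`: the part of
validity that the consistency of the estimator rests on. -/
structure IsDensityFamily (ν : Measure ℝ) (A : Set ℝ) (f : ℝ → ℝ → ℝ) : Prop where
  measurableSet : MeasurableSet A
  nonneg : ∀ x ∈ A, ∀ y, 0 ≤ f x y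
  integral_eq_one : ∀ y, ∫ x in A, f x y ∂ν = 1

theorem IsValid.isDensityFamily (h : IsValid ν A f) : IsDensityFamily ν A f :=
  ⟨h.measurableSet, h.nonneg, h.integral_eq_one⟩

theorem IsDensityFamily.nonempty (h : IsDensityFamily ν A f) : A.Nonempty := by
  by_contra hA
  simpa [Set.not_nonempty_iff_eq_empty.1 hA] using h.integral_eq_one 0

namespace StrictlyLogConcave

theorem strictAnti_score (h : StrictlyLogConcave A f) {x : ℝ} (hx : x ∈ A) :
    StrictAnti (score f x) :=
  strictAnti_of_deriv_neg (h.scoreDeriv_neg x hx)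

theorem strictConcaveOn_log (h : StrictlyLogConcave A f) {x : ℝ} (hx : x ∈ A) :
    StrictConcaveOn ℝ Set.univ fun y => Real.log (f x y) :=
  StrictAnti.strictConcaveOn_univ_of_deriv (h.differentiable_log x hx).continuous
    (h.strictAnti_score hx)

theorem hasDerivAt_log (h : StrictlyLogConcave A f) {x : ℝ} (hx : x ∈ A) (y : ℝ) :
    HasDerivAt (fun y => Real.log (f x y)) (score f x y) y :=
  (h.differentiable_log x hx y).hasDerivAt

theorem log_add_le (h : StrictlyLogConcave A f) {x : ℝ} (hx : x ∈ A) (y s : ℝ) :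
    Real.log (f x (y + s)) ≤ Real.log (f x y) + s * score f x y := by
  have hconc := (h.strictConcaveOn_log hx).concaveOn
  have hderiv := h.hasDerivAt_log hx y
  rcases lt_trichotomy s 0 with hs | rfl | hs
  · have hslope := hconc.le_slope_of_hasDerivAt (Set.mem_univ (y + s)) (Set.mem_univ y)
      (by linarith) hderiv
    rw [slope_def_field, le_div_iff₀ (by linarith)] at hslope
    linarith
  · simp
  · have hslope := hconc.slope_le_of_hasDerivAt (Set.mem_univ y) (Set.mem_univ (y + s))
      (by linarith) hderiv
    rw [slope_def_field, div_le_iff₀ (by linarith)] at hslope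
    linarith

theorem log_add_lt (h : StrictlyLogConcave A f) {x : ℝ} (hx : x ∈ A) (y : ℝ) {s : ℝ}
    (hs : s ≠ 0) : Real.log (f x (y + s)) < Real.log (f x y) + s * score f x y := by
  have hmid := (h.strictConcaveOn_log hx).2 (Set.mem_univ y) (Set.mem_univ (y + s))
    (by simpa using hs) one_half_pos one_half_pos (by norm_num)
  have htangent := h.log_add_le hx y (s / 2)
  have hhalf : (1 / 2 : ℝ) • y + (1 / 2 : ℝ) • (y + s) = y + s / 2 := by
    simp only [smul_eq_mul]
    ring
  rw [hhalf] at hmid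
  simp only [smul_eq_mul] at hmid
  linarith

theorem le_mul_exp (h : StrictlyLogConcave A f) {x : ℝ} (hx : x ∈ A) (y s : ℝ) :
    f x (y + s) ≤ f x y * Real.exp (s * score f x y) := by
  simpa only [Real.exp_add, Real.exp_log (h.pos x hx _)] using
    Real.exp_le_exp.2 (h.log_add_le hx y s)

theorem lt_mul_exp (h : StrictlyLogConcave A f) {x : ℝ} (hx : x ∈ A) (y : ℝ) {s : ℝ}
    (hs : s ≠ 0) : f x (y + s) < f x y * Real.exp (s * score f x y) := by
  simpa only [Real.exp_add, Real.exp_log (h.pos x hx _)] using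
    Real.exp_lt_exp.2 (h.log_add_lt hx y hs)

theorem score_sub_le (h : StrictlyLogConcave A f) {x : ℝ} (hx : x ∈ A) {c r : ℝ}
    (hc : ∀ y, |y| ≤ r → c ≤ |scoreDeriv f x y|) {a b : ℝ} (ha : |a| ≤ r) (hb : |b| ≤ r)
    (hab : a ≤ b) : score f x b - score f x a ≤ -c * (b - a) := by
  refine (convex_Icc (-r) r).image_sub_le_mul_sub_of_deriv_le
    (h.differentiable_score x hx).continuous.continuousOn
    (h.differentiable_score x hx).differentiableOn (fun y hy => ?_) a (abs_le.1 ha) b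
    (abs_le.1 hb) hab
  rw [interior_Icc] at hy
  have hcurv := hc y (abs_le.2 ⟨hy.1.le, hy.2.le⟩)
  rw [abs_of_neg (h.scoreDeriv_neg x hx y)] at hcurv
  exact le_neg_of_le_neg hcurv

theorem mul_score_sub_le (h : StrictlyLogConcave A f) {x : ℝ} (hx : x ∈ A) {c r : ℝ}
    (hc : ∀ y, |y| ≤ r → c ≤ |scoreDeriv f x y|) {a b : ℝ} (ha : |a| ≤ r) (hb : |b| ≤ r)
    {σ : ℝ} (hσ : 0 ≤ σ * (b - a)) :
    σ * (score f x b - score f x a) ≤ -c * (σ * (b - a)) := by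
  rcases lt_trichotomy a b with hab | rfl | hab
  · have hσ0 : 0 ≤ σ := nonneg_of_mul_nonneg_left hσ (sub_pos.2 hab)
    linarith [mul_le_mul_of_nonneg_left (h.score_sub_le hx hc ha hb hab.le) hσ0]
  · simp
  · have hσ0 : 0 ≤ -σ := nonneg_of_mul_nonneg_left (by linarith) (sub_pos.2 hab)
    linarith [mul_le_mul_of_nonneg_left (h.score_sub_le hx hc hb ha hab.le) hσ0]

end StrictlyLogConcave

end LinkFunction

section Expansion

variable {n : ℕ} {m : Pair n → ℕ} {d : Fin n → ℝ} {R κ δ : ℝ}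

/-- The increment of the indicator function of `U` along a pair. -/
def cutSign (U : Finset (Fin n)) (e : Pair n) : ℝ :=
  (if e.1.1 ∈ U then 1 else 0) - (if e.1.2 ∈ U then 1 else 0)

/-- The pairs with one member in `S` and the other one in `W`. -/
def pairsBetween (S W : Finset (Fin n)) : Finset (Pair n) :=
  {e | e.1.1 ∈ S ∧ e.1.2 ∈ W ∨ e.1.2 ∈ S ∧ e.1.1 ∈ W}

/-- The number of comparisons between `S` and `W` when each pair `e` is compared `m e` times. -/
def cutWeight (m : Pair n → ℕ) (S W : Finset (Fin n)) : ℕ :=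
  ∑ e ∈ pairsBetween S W, m e

/-- Expansion of the comparison graph with multiplicities `m`: every set is compared often with the
complement of any larger set, as long as that set exceeds it at most by a factor `R` and contains
at most half of the subjects. -/
def Expands (m : Pair n → ℕ) (R κ : ℝ) : Prop :=
  ∀ S S' : Finset (Fin n), S.Nonempty → S ⊆ S' → (S'.card : ℝ) ≤ R * S.card → 2 * S'.card ≤ n →
    κ * S.card < cutWeight m S S'ᶜ

/-- `U` is a set of the form `{i | a ≤ d i}`, possibly empty. -/
def IsUpperLevelSet (d : Fin n → ℝ) (U : Finset (Fin n)) : Prop :=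
  ∀ i ∈ U, ∀ j ∉ U, d j < d i

/-- The upper level set of `d` at height `a`. -/
def upperLevel (d : Fin n → ℝ) (a : ℝ) : Finset (Fin n) :=
  {i | a ≤ d i}

/-- The total decrease of `d` across the boundary of `U`, over all comparisons. -/
def boundaryFlux (m : Pair n → ℕ) (d : Fin n → ℝ) (U : Finset (Fin n)) : ℝ :=
  ∑ e, m e * (cutSign U e * (d e.1.1 - d e.1.2))

theorem cutSign_compl (U : Finset (Fin n)) (e : Pair n) : cutSign Uᶜ e = -cutSign U e := by
  by_cases hi : e.1.1 ∈ U <;> by_cases hj : e.1.2 ∈ U <;> simp [cutSign, hi, hj]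

theorem cutSign_eq_sum (U : Finset (Fin n)) (e : Pair n) :
    cutSign U e = ∑ i ∈ U, cutSign {i} e := by
  simp [cutSign, Finset.sum_sub_distrib]

theorem boundaryFlux_compl (m : Pair n → ℕ) (d : Fin n → ℝ) (U : Finset (Fin n)) :
    boundaryFlux m d Uᶜ = boundaryFlux m (-d) U := by
  refine Finset.sum_congr rfl fun e _ => ?_
  rw [cutSign_compl, Pi.neg_apply, Pi.neg_apply]
  ring

theorem mem_upperLevel {a : ℝ} {i : Fin n} : i ∈ upperLevel d a ↔ a ≤ d i := by
  simp [upperLevel]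

theorem upperLevel_anti (d : Fin n → ℝ) : Antitone (upperLevel d) := fun _ _ hab _ hi =>
  mem_upperLevel.2 (hab.trans (mem_upperLevel.1 hi))

theorem isUpperLevelSet_upperLevel (d : Fin n → ℝ) (a : ℝ) :
    IsUpperLevelSet d (upperLevel d a) := fun _ hi _ hj =>
  (not_le.1 (mt mem_upperLevel.2 hj)).trans_le (mem_upperLevel.1 hi)

theorem IsUpperLevelSet.compl {U : Finset (Fin n)} (hU : IsUpperLevelSet (-d) U) :
    IsUpperLevelSet d Uᶜ := fun i hi j hj =>
  neg_lt_neg_iff.1 (hU j (by simpa using hj) i (by simpa using hi))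

theorem IsUpperLevelSet.cutSign_mul_nonneg {U : Finset (Fin n)} (hU : IsUpperLevelSet d U)
    (e : Pair n) : 0 ≤ cutSign U e * (d e.1.1 - d e.1.2) := by
  by_cases hi : e.1.1 ∈ U <;> by_cases hj : e.1.2 ∈ U <;>
    simp only [cutSign, hi, hj, if_true, if_false]
  · simp
  · linarith [hU _ hi _ hj]
  · linarith [hU _ hj _ hi]
  · simp

theorem IsUpperLevelSet.mul_cutWeight_le_boundaryFlux {S S' : Finset (Fin n)}
    (hS : IsUpperLevelSet d S) (hSS' : S ⊆ S') (hδ : ∀ i ∈ S, ∀ j ∉ S', d j + δ ≤ d i) :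
    δ * cutWeight m S S'ᶜ ≤ boundaryFlux m d S := by
  rw [cutWeight, Nat.cast_sum, Finset.mul_sum]
  refine (Finset.sum_le_sum fun e he => ?_).trans (Finset.sum_le_sum_of_subset_of_nonneg
    (Finset.subset_univ _) fun e _ _ => mul_nonneg (Nat.cast_nonneg _) (hS.cutSign_mul_nonneg e))
  rw [mul_comm]
  refine mul_le_mul_of_nonneg_left ?_ (Nat.cast_nonneg _)
  simp only [pairsBetween, Finset.mem_filter_univ, Finset.mem_compl] at he
  rcases he with ⟨hi, hj⟩ | ⟨hi, hj⟩
  · simp only [cutSign, hi, mt (@hSS' _) hj, if_true, if_false]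
    linarith [hδ _ hi _ hj]
  · simp only [cutSign, hi, mt (@hSS' _) hj, if_true, if_false]
    linarith [hδ _ hi _ hj]

/-- A slowly growing level set would have many comparisons with subjects that lie lower by `δ`,
hence a large flux. -/
theorem Expands.mul_card_upperLevel_lt_or (hexp : Expands m R κ) (hδ : 0 < δ)
    (hflux : ∀ U, IsUpperLevelSet d U → boundaryFlux m d U ≤ δ * (κ * U.card)) {a : ℝ}
    (hne : (upperLevel d a).Nonempty) :
    R * (upperLevel d a).card < ((upperLevel d (a - δ)).card : ℝ) ∨
      n < 2 * (upperLevel d (a - δ)).card := by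
  by_contra! hcon
  have hsub : upperLevel d a ⊆ upperLevel d (a - δ) := upperLevel_anti d (by linarith)
  have hlevel := isUpperLevelSet_upperLevel d a
  have hlower : δ * cutWeight m (upperLevel d a) (upperLevel d (a - δ))ᶜ ≤
      boundaryFlux m d (upperLevel d a) :=
    hlevel.mul_cutWeight_le_boundaryFlux hsub fun i hi j hj => by
      rw [mem_upperLevel] at hi hj
      linarith
  have hmany := mul_lt_mul_of_pos_left (hexp _ _ hne hsub hcon.1 hcon.2) hδ
  linarith [hflux _ hlevel]

theorem Expands.pow_le_card_upperLevel_or (hexp : Expands m R κ) (hR : 0 ≤ R) (hδ : 0 < δ)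
    (hflux : ∀ U, IsUpperLevelSet d U → boundaryFlux m d U ≤ δ * (κ * U.card)) (i : Fin n)
    (k : ℕ) : R ^ k ≤ ((upperLevel d (d i - k * δ)).card : ℝ) ∨
      n < 2 * (upperLevel d (d i - k * δ)).card := by
  have hne (k : ℕ) : (upperLevel d (d i - k * δ)).Nonempty :=
    ⟨i, mem_upperLevel.2 (sub_le_self _ (by positivity))⟩
  induction k with
  | zero => exact Or.inl ((pow_zero R).trans_le (Nat.one_le_cast.2 (hne 0).card_pos))
  | succ k ih =>
    have hsucc : d i - (k + 1 : ℕ) * δ = d i - k * δ - δ := by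
      push_cast
      ring
    rw [hsucc]
    rcases ih with ih | ih
    · refine (hexp.mul_card_upperLevel_lt_or hδ hflux (hne k)).imp_left fun hgrow => ?_
      rw [pow_succ']
      exact (mul_le_mul_of_nonneg_left ih hR).trans hgrow.le
    · exact Or.inr (ih.trans_le (Nat.mul_le_mul_left 2
        (Finset.card_le_card (upperLevel_anti d (by linarith)))))

theorem Expands.lt_two_mul_card_upperLevel (hexp : Expands m R κ) (hR : 0 ≤ R) (hδ : 0 < δ)
    (hflux : ∀ U, IsUpperLevelSet d U → boundaryFlux m d U ≤ δ * (κ * U.card)) {K : ℕ}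
    (hK : n ≤ R ^ K) (i : Fin n) : n < 2 * (upperLevel d (d i - K * δ)).card := by
  rcases hexp.pow_le_card_upperLevel_or hR hδ hflux i K with hpow | hhalf
  · have hall : n ≤ (upperLevel d (d i - K * δ)).card := by exact_mod_cast hK.trans hpow
    have := i.pos
    omega
  · exact hhalf

theorem Expands.sub_le (hexp : Expands m R κ) (hR : 0 ≤ R) (hδ : 0 < δ)
    (hflux : ∀ U, IsUpperLevelSet d U → boundaryFlux m d U ≤ δ * (κ * U.card))
    (hflux_neg : ∀ U, IsUpperLevelSet (-d) U → boundaryFlux m (-d) U ≤ δ * (κ * U.card))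
    {K : ℕ} (hK : n ≤ R ^ K) (i j : Fin n) : d i - d j ≤ 2 * (K * δ) := by
  have hupper := hexp.lt_two_mul_card_upperLevel hR hδ hflux hK i
  have hlower := hexp.lt_two_mul_card_upperLevel hR hδ hflux_neg hK j
  obtain ⟨k, hk⟩ := Finset.inter_nonempty_of_card_lt_card_add_card
    (Finset.subset_univ (upperLevel d (d i - K * δ)))
    (Finset.subset_univ (upperLevel (-d) ((-d) j - K * δ)))
    (by rw [Finset.card_univ, Fintype.card_fin]; omega)
  simp only [Finset.mem_inter, mem_upperLevel, Pi.neg_apply] at hk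
  linarith [hk.1, hk.2]

theorem Expands.exists_mem_pairsBetween (hexp : Expands m R κ) (hR : 1 ≤ R) (hκ : 0 ≤ κ)
    {S : Finset (Fin n)} (hS : S.Nonempty) (hcard : 2 * S.card ≤ n) :
    ∃ e ∈ pairsBetween S Sᶜ, m e ≠ 0 := by
  have hcut := hexp S S hS subset_rfl (le_mul_of_one_le_left (Nat.cast_nonneg _) hR) hcard
  have hpos : (0 : ℝ) < cutWeight m S Sᶜ := lt_of_le_of_lt (by positivity) hcut
  exact Finset.exists_ne_zero_of_sum_ne_zero (by exact_mod_cast hpos.ne')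

theorem Expands.eq_of_forall_ne_zero (hexp : Expands m R κ) (hR : 1 ≤ R) (hκ : 0 ≤ κ)
    (hd : ∀ e, m e ≠ 0 → d e.1.1 = d e.1.2) (i j : Fin n) : d i = d j := by
  have hcross (S : Finset (Fin n)) (hS : S.Nonempty) (hcard : 2 * S.card ≤ n) :
      ∃ a ∈ S, ∃ b ∉ S, d a = d b := by
    obtain ⟨e, he, hm⟩ := hexp.exists_mem_pairsBetween hR hκ hS hcard
    simp only [pairsBetween, Finset.mem_filter_univ, Finset.mem_compl] at he
    rcases he with ⟨ha, hb⟩ | ⟨ha, hb⟩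
    · exact ⟨_, ha, _, hb, hd e hm⟩
    · exact ⟨_, ha, _, hb, (hd e hm).symm⟩
  by_contra hij
  set S : Finset (Fin n) := {k | d k = d i} with hS
  have hsplit : S.card + Sᶜ.card = n := by rw [Finset.card_add_card_compl, Fintype.card_fin]
  rcases le_total (2 * S.card) n with hcard | hcard
  · obtain ⟨a, ha, b, hb, hab⟩ := hcross S ⟨i, by simp [hS]⟩ hcard
    simp only [hS, Finset.mem_filter_univ] at ha hb
    exact hb (hab ▸ ha)
  · obtain ⟨a, ha, b, hb, hab⟩ := hcross Sᶜ ⟨j, by simp [hS, Ne.symm hij]⟩ (by omega)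
    simp only [hS, Finset.mem_compl, Finset.mem_filter_univ, not_not] at ha hb
    exact ha (hab.trans hb)

end Expansion

section Likelihood

variable {A : Set ℝ} {f : ℝ → ℝ → ℝ} {T n : ℕ} {N : Pair n → ℕ} {X : Pair n → Fin T → ℝ}
  {u v w : Fin n → ℝ}

/-- The number of observed comparisons of a pair. It is `N e` when `N e ≤ T`. -/
def count (T : ℕ) (N : Pair n → ℕ) (e : Pair n) : ℕ :=
  (Finset.univ.filter fun t : Fin T => t.val < N e).card

/-- The derivative of the log-likelihood at `w` in the direction of the indicator of `U`. -/
def scoreSum (f : ℝ → ℝ → ℝ) (N : Pair n → ℕ) (X : Pair n → Fin T → ℝ) (w : Fin n → ℝ)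
    (U : Finset (Fin n)) : ℝ :=
  ∑ e : Pair n, ∑ t : Fin T with t.val < N e,
    cutSign U e * score f (X e t) (w e.1.1 - w e.1.2)

/-- The parameters whose error has oscillation at most `1`. The curvature constants of the model
control the log-likelihood there. -/
def nearSpace (u : Fin n → ℝ) : Set (Fin n → ℝ) :=
  {v | ∀ i j, (v - u) i - (v - u) j ≤ 1}

theorem abs_sub_le_dynamicRange (u : Fin n → ℝ) (i j : Fin n) : |u i - u j| ≤ dynamicRange u :=
  (le_ciSup (f := fun j => |u i - u j|) (Set.finite_range _).bddAbove j).trans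
    (le_ciSup (f := fun i => ⨆ j, |u i - u j|) (Set.finite_range _).bddAbove i)

theorem dynamicRange_nonneg (u : Fin n → ℝ) : 0 ≤ dynamicRange u :=
  Real.iSup_nonneg fun _ => Real.iSup_nonneg fun _ => abs_nonneg _

theorem abs_sub_le_of_mem_nearSpace (hv : v ∈ nearSpace u) (i j : Fin n) :
    |v i - v j| ≤ dynamicRange u + 1 := by
  have hu := abs_le.1 (abs_sub_le_dynamicRange u i j)
  have hij := hv i j
  have hji := hv j i
  simp only [Pi.sub_apply] at hij hji
  exact abs_le.2 ⟨by linarith, by linarith⟩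

theorem scoreSum_compl (w : Fin n → ℝ) (U : Finset (Fin n)) :
    scoreSum f N X w Uᶜ = -scoreSum f N X w U := by
  simp [scoreSum, cutSign_compl]

theorem scoreSum_eq_sum (w : Fin n → ℝ) (U : Finset (Fin n)) :
    scoreSum f N X w U = ∑ i ∈ U, scoreSum f N X w {i} := by
  simp_rw [scoreSum]
  rw [Finset.sum_comm]
  refine Finset.sum_congr rfl fun e _ => ?_
  rw [Finset.sum_comm]
  refine Finset.sum_congr rfl fun t _ => ?_
  rw [cutSign_eq_sum, Finset.sum_mul]

theorem abs_scoreSum_le {B : ℝ} (hB : ∀ i, |scoreSum f N X w {i}| ≤ B) (U : Finset (Fin n)) :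
    |scoreSum f N X w U| ≤ B * U.card := by
  rw [scoreSum_eq_sum]
  refine (Finset.abs_sum_le_sum_abs _ _).trans ?_
  simpa [mul_comm] using Finset.sum_le_card_nsmul U _ B fun i _ => hB i

theorem logLikelihood_add_const (w : Fin n → ℝ) (s : ℝ) :
    logLikelihood f N X (fun i => w i + s) = logLikelihood f N X w := by
  simp [logLikelihood]

theorem continuous_logLikelihood (hconc : StrictlyLogConcave A f) (hX : ∀ e t, X e t ∈ A) :
    Continuous (logLikelihood f N X) :=
  continuous_finsetSum _ fun e _ => continuous_finsetSum _ fun t _ =>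
    (hconc.differentiable_log _ (hX e t)).continuous.comp (by fun_prop)

theorem hasDerivAt_logLikelihood (hconc : StrictlyLogConcave A f) (hX : ∀ e t, X e t ∈ A)
    (w d : Fin n → ℝ) :
    HasDerivAt (fun s : ℝ => logLikelihood f N X (w + s • d))
      (∑ e : Pair n, ∑ t : Fin T with t.val < N e,
        (d e.1.1 - d e.1.2) * score f (X e t) (w e.1.1 - w e.1.2)) 0 := by
  refine HasDerivAt.fun_sum fun e _ => HasDerivAt.fun_sum fun t _ => ?_
  have hline : HasDerivAt (fun s : ℝ => (w + s • d) e.1.1 - (w + s • d) e.1.2)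
      (d e.1.1 - d e.1.2) 0 := by
    simpa using (((hasDerivAt_id (0 : ℝ)).mul_const (d e.1.1)).const_add (w e.1.1)).fun_sub
      (((hasDerivAt_id (0 : ℝ)).mul_const (d e.1.2)).const_add (w e.1.2))
  have hlog : HasDerivAt (fun y => Real.log (f (X e t) y))
      (score f (X e t) (w e.1.1 - w e.1.2))
      ((w + (0 : ℝ) • d) e.1.1 - (w + (0 : ℝ) • d) e.1.2) := by
    simpa using hconc.hasDerivAt_log (hX e t) (w e.1.1 - w e.1.2)
  exact (hlog.comp (0 : ℝ) hline).congr_deriv (mul_comm _ _)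

theorem concaveOn_logLikelihood (hconc : StrictlyLogConcave A f) (hX : ∀ e t, X e t ∈ A) :
    ConcaveOn ℝ Set.univ (logLikelihood f N X) := by
  refine ⟨convex_univ, fun w _ w' _ a b ha hb hab => ?_⟩
  simp only [logLikelihood, Finset.smul_sum, ← Finset.sum_add_distrib]
  refine Finset.sum_le_sum fun e _ => Finset.sum_le_sum fun t _ => ?_
  refine ((hconc.strictConcaveOn_log (hX e t)).concaveOn.2 (Set.mem_univ _) (Set.mem_univ _)
    ha hb hab).trans_eq ?_
  simp only [Pi.add_apply, Pi.smul_apply, smul_sub, sub_add_sub_comm]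

theorem logLikelihood_lt_of_ne (hconc : StrictlyLogConcave A f) (hX : ∀ e t, X e t ∈ A)
    {e : Pair n} (he : count T N e ≠ 0) (hne : v e.1.1 - v e.1.2 ≠ w e.1.1 - w e.1.2)
    {a b : ℝ} (ha : 0 < a) (hb : 0 < b) (hab : a + b = 1) :
    a • logLikelihood f N X v + b • logLikelihood f N X w <
      logLikelihood f N X (a • v + b • w) := by
  have hcomb (e : Pair n) : (a • v + b • w) e.1.1 - (a • v + b • w) e.1.2 =
      a • (v e.1.1 - v e.1.2) + b • (w e.1.1 - w e.1.2) := by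
    simp only [Pi.add_apply, Pi.smul_apply, smul_sub, sub_add_sub_comm]
  simp only [logLikelihood, Finset.smul_sum, ← Finset.sum_add_distrib, hcomb]
  refine Finset.sum_lt_sum (fun e _ => Finset.sum_le_sum fun t _ =>
      (hconc.strictConcaveOn_log (hX e t)).concaveOn.2 (Set.mem_univ _) (Set.mem_univ _)
        ha.le hb.le hab)
    ⟨e, Finset.mem_univ _, Finset.sum_lt_sum_of_nonempty (Finset.card_ne_zero.1 he) fun t _ =>
      (hconc.strictConcaveOn_log (hX e t)).2 (Set.mem_univ _) (Set.mem_univ _) hne ha hb hab⟩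

theorem isClosed_paramSpace_inter_nearSpace (u : Fin n → ℝ) :
    IsClosed (paramSpace n ∩ nearSpace u) := by
  simp only [paramSpace, nearSpace, Set.ofPred_forall, Pi.sub_apply]
  exact (isClosed_iInter fun i => isClosed_iInter fun _ =>
      isClosed_eq (continuous_apply i) continuous_const).inter
    (isClosed_iInter fun i => isClosed_iInter fun j =>
      isClosed_le (by fun_prop) continuous_const)

theorem norm_sub_le_of_mem_paramSpace (hu : u ∈ paramSpace n) (hv : v ∈ paramSpace n) {ε : ℝ}
    (hε : 0 ≤ ε) (hosc : ∀ i j, (v - u) i - (v - u) j ≤ ε) : ‖v - u‖ ≤ ε := by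
  refine (pi_norm_le_iff_of_nonneg hε).2 fun i => ?_
  have hzero : (v - u) ⟨0, i.pos⟩ = 0 := by
    rw [Pi.sub_apply, hv _ rfl, hu _ rfl, sub_zero]
  have hupper := hosc i ⟨0, i.pos⟩
  have hlower := hosc ⟨0, i.pos⟩ i
  rw [hzero] at hupper hlower
  exact abs_le.2 ⟨by linarith, by linarith⟩

theorem exists_isMaxOn_nearSpace (hconc : StrictlyLogConcave A f) (hX : ∀ e t, X e t ∈ A)
    (hu : u ∈ paramSpace n) (hn : 0 < n) :
    ∃ v ∈ paramSpace n, v ∈ nearSpace u ∧ IsMaxOn (logLikelihood f N X) (nearSpace u) v := by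
  have hcompact : IsCompact (paramSpace n ∩ nearSpace u) :=
    (isCompact_closedBall u 1).of_isClosed_subset (isClosed_paramSpace_inter_nearSpace u)
      fun v hv => by
        rw [Metric.mem_closedBall, dist_eq_norm]
        exact norm_sub_le_of_mem_paramSpace hu hv.1 zero_le_one hv.2
  obtain ⟨v, hv, hmax⟩ := hcompact.exists_isMaxOn ⟨u, hu, fun i j => by simp⟩
    (continuous_logLikelihood (N := N) hconc hX).continuousOn
  refine ⟨v, hv.1, hv.2, fun w hw => ?_⟩
  -- The likelihood does not change when `w` is translated so as to satisfy the normalization.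
  have htranslate := hmax (a := fun i => w i + -(w ⟨0, hn⟩)) ⟨fun i hi => ?_, fun i j => ?_⟩
  · simpa only [Set.mem_ofPred_eq, logLikelihood_add_const] using htranslate
  · simp [show i = ⟨0, hn⟩ from Fin.ext hi]
  · have hij := hw i j
    simp only [Pi.sub_apply] at hij ⊢
    linarith

theorem eventually_mem_nearSpace_of_isUpperLevelSet (hv : v ∈ nearSpace u) {U : Finset (Fin n)}
    (hU : IsUpperLevelSet (v - u) U) :
    ∀ᶠ s : ℝ in 𝓝[>] 0, v + s • (fun i => if i ∈ U then (-1 : ℝ) else 0) ∈ nearSpace u := by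
  have hgap : ∀ᶠ s : ℝ in 𝓝[>] 0, ∀ i ∈ U, ∀ j, j ∉ U → s < (v - u) i - (v - u) j := by
    refine (Filter.eventually_all_finset U).2 fun i hi => eventually_all.2 fun j => ?_
    by_cases hj : j ∈ U
    · simp [hj]
    · filter_upwards [mem_nhdsWithin_of_mem_nhds (eventually_lt_nhds (sub_pos.2 (hU i hi j hj)))]
        with s hs _ using hs
  filter_upwards [hgap, self_mem_nhdsWithin] with s hs (hs0 : 0 < s) i j
  have hij := hv i j
  by_cases hi : i ∈ U <;> by_cases hj : j ∈ U <;>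
    simp only [Pi.sub_apply, Pi.add_apply, Pi.smul_apply, smul_eq_mul, hi, hj, if_true,
      if_false] at hij ⊢
  · linarith
  · linarith
  · have hji := hs j hj i hi
    simp only [Pi.sub_apply] at hji
    linarith
  · linarith

/-- The first order condition for moving the coordinates in `U` downwards, which keeps the
parameter in `nearSpace u` because the error is larger on `U` than off `U`. -/
theorem scoreSum_nonneg_of_isMaxOn (hconc : StrictlyLogConcave A f) (hX : ∀ e t, X e t ∈ A)
    (hv : v ∈ nearSpace u) (hmax : IsMaxOn (logLikelihood f N X) (nearSpace u) v)
    {U : Finset (Fin n)} (hU : IsUpperLevelSet (v - u) U) : 0 ≤ scoreSum f N X v U := by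
  set d : Fin n → ℝ := fun i => if i ∈ U then -1 else 0 with hd
  have hderiv : HasDerivAt (fun s : ℝ => logLikelihood f N X (v + s • d))
      (-scoreSum f N X v U) 0 := by
    convert hasDerivAt_logLikelihood (N := N) hconc hX v d using 1
    simp only [scoreSum, ← Finset.sum_neg_distrib]
    refine Finset.sum_congr rfl fun e _ => Finset.sum_congr rfl fun t _ => ?_
    by_cases hi : e.1.1 ∈ U <;> by_cases hj : e.1.2 ∈ U <;> simp [hd, cutSign, hi, hj]
  have hlocal : IsLocalMaxOn (fun s : ℝ => logLikelihood f N X (v + s • d))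
      {s | v + s • d ∈ nearSpace u} 0 :=
    IsMaxOn.localize fun s hs => by simpa using hmax hs
  have hcone : (1 : ℝ) ∈ posTangentConeAt {s : ℝ | v + s • d ∈ nearSpace u} 0 :=
    one_mem_posTangentConeAt_iff_frequently.2
      (eventually_mem_nearSpace_of_isUpperLevelSet hv hU).frequently
  simpa using hlocal.hasFDerivWithinAt_nonpos hderiv.hasDerivWithinAt.hasFDerivWithinAt hcone

/-- The curvature turns the first order condition into a bound on the flux of the error. -/
theorem mul_boundaryFlux_le_scoreSum (hconc : StrictlyLogConcave A f) (hX : ∀ e t, X e t ∈ A)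
    {c : ℝ} (hc : ∀ x ∈ A, ∀ y, |y| ≤ dynamicRange u + 1 → c ≤ |scoreDeriv f x y|)
    (hv : v ∈ nearSpace u) (hmax : IsMaxOn (logLikelihood f N X) (nearSpace u) v)
    {U : Finset (Fin n)} (hU : IsUpperLevelSet (v - u) U) :
    c * boundaryFlux (count T N) (v - u) U ≤ scoreSum f N X u U := by
  suffices hdecrease : scoreSum f N X v U - scoreSum f N X u U ≤
      -c * boundaryFlux (count T N) (v - u) U by
    linarith [scoreSum_nonneg_of_isMaxOn hconc hX hv hmax hU]
  simp only [scoreSum, boundaryFlux, Finset.mul_sum, ← Finset.sum_sub_distrib, ← mul_sub]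
  refine Finset.sum_le_sum fun e _ => ?_
  rw [mul_left_comm, ← nsmul_eq_mul, count]
  refine Finset.sum_le_card_nsmul _ _ _ fun t _ => ?_
  have hsign := hU.cutSign_mul_nonneg e
  simp only [Pi.sub_apply, sub_sub_sub_comm _ (u _)] at hsign ⊢
  exact hconc.mul_score_sub_le (hX e t) (hc _ (hX e t))
    ((abs_sub_le_dynamicRange u _ _).trans (le_add_of_nonneg_right zero_le_one))
    (abs_sub_le_of_mem_nearSpace hv _ _) hsign

theorem sub_le_of_expands (hconc : StrictlyLogConcave A f) (hX : ∀ e t, X e t ∈ A)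
    {c R κ δ : ℝ} (hc0 : 0 < c)
    (hc : ∀ x ∈ A, ∀ y, |y| ≤ dynamicRange u + 1 → c ≤ |scoreDeriv f x y|)
    (hexp : Expands (count T N) R κ) (hR : 0 ≤ R) (hδ : 0 < δ)
    (hnoise : ∀ i, |scoreSum f N X u {i}| ≤ c * (δ * κ)) {K : ℕ} (hK : n ≤ R ^ K)
    (hv : v ∈ nearSpace u) (hmax : IsMaxOn (logLikelihood f N X) (nearSpace u) v)
    (i j : Fin n) : (v - u) i - (v - u) j ≤ 2 * (K * δ) := by
  refine hexp.sub_le hR hδ (fun U hU => ?_) (fun U hU => ?_) hK i j <;>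
    refine le_of_mul_le_mul_left ?_ hc0
  · linarith [mul_boundaryFlux_le_scoreSum hconc hX hc hv hmax hU,
      (le_abs_self _).trans (abs_scoreSum_le hnoise U)]
  · have hflux := mul_boundaryFlux_le_scoreSum hconc hX hc hv hmax hU.compl
    rw [boundaryFlux_compl, scoreSum_compl] at hflux
    linarith [(neg_le_abs _).trans (abs_scoreSum_le hnoise U)]

theorem logLikelihood_le_of_isMaxOn_nearSpace (hconc : StrictlyLogConcave A f)
    (hX : ∀ e t, X e t ∈ A) (hmax : IsMaxOn (logLikelihood f N X) (nearSpace u) v)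
    (hosc : ∀ i j, (v - u) i - (v - u) j < 1) (w : Fin n → ℝ) :
    logLikelihood f N X w ≤ logLikelihood f N X v := by
  have hinterior : nearSpace u ∈ 𝓝 v := by
    have hopen (i j : Fin n) : ∀ᶠ w in 𝓝 v, (w - u) i - (w - u) j < 1 :=
      ContinuousAt.eventually_lt (by simp only [Pi.sub_apply]; fun_prop) continuousAt_const
        (hosc i j)
    filter_upwards [eventually_all.2 fun i => eventually_all.2 (hopen i)] with w hw i j
      using (hw i j).le
  exact IsMaxOn.of_isLocalMax_of_convex_univ (hmax.isLocalMax hinterior)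
    (concaveOn_logLikelihood hconc hX) w

theorem isUniqueMLE_of_forall_le (hconc : StrictlyLogConcave A f) (hX : ∀ e t, X e t ∈ A)
    {R κ : ℝ} (hexp : Expands (count T N) R κ) (hR : 1 ≤ R) (hκ : 0 ≤ κ)
    (hv : v ∈ paramSpace n) (hglobal : ∀ w, logLikelihood f N X w ≤ logLikelihood f N X v) :
    IsUniqueMLE f N X v := by
  refine ⟨⟨hv, fun w _ => hglobal w⟩, fun w hw => ?_⟩
  have hwv : logLikelihood f N X w = logLikelihood f N X v :=
    le_antisymm (hglobal w) (hw.2 hv)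
  have hconst := hexp.eq_of_forall_ne_zero (d := w - v) hR hκ fun e he => by
    by_contra hne
    have hlt := logLikelihood_lt_of_ne (v := w) (w := v) hconc hX he
      (fun heq => hne (by simp only [Pi.sub_apply]; linarith)) one_half_pos one_half_pos
      (add_halves 1)
    rw [hwv, ← add_smul, add_halves, one_smul] at hlt
    exact (hglobal _).not_gt hlt
  funext i
  have hi := hconst i ⟨0, i.pos⟩
  rwa [Pi.sub_apply, Pi.sub_apply, hw.1 ⟨0, i.pos⟩ rfl, hv ⟨0, i.pos⟩ rfl, sub_zero,
    sub_eq_zero] at hi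

theorem exists_isUniqueMLE_of_expands (hconc : StrictlyLogConcave A f) (hX : ∀ e t, X e t ∈ A)
    (hu : u ∈ paramSpace n) (hn : 0 < n) {c R κ δ : ℝ} (hc0 : 0 < c)
    (hc : ∀ x ∈ A, ∀ y, |y| ≤ dynamicRange u + 1 → c ≤ |scoreDeriv f x y|)
    (hexp : Expands (count T N) R κ) (hR : 1 ≤ R) (hκ : 0 ≤ κ) (hδ : 0 < δ)
    (hnoise : ∀ i, |scoreSum f N X u {i}| ≤ c * (δ * κ)) {K : ℕ} (hK : n ≤ R ^ K)
    (hsmall : 2 * (K * δ) < 1) :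
    ∃ v, IsUniqueMLE f N X v ∧ ‖v - u‖ ≤ 2 * (K * δ) := by
  obtain ⟨v, hvp, hv, hmax⟩ := exists_isMaxOn_nearSpace (N := N) hconc hX hu hn
  have hosc := sub_le_of_expands hconc hX hc0 hc hexp (zero_le_one.trans hR) hδ hnoise hK hv hmax
  exact ⟨v, isUniqueMLE_of_forall_le hconc hX hexp hR hκ hvp
      (logLikelihood_le_of_isMaxOn_nearSpace hconc hX hmax fun i j => (hosc i j).trans_lt hsmall),
    norm_sub_le_of_mem_paramSpace hu hvp (by positivity) hosc⟩

end Likelihood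

section SubGaussian

variable {α : Type*} [MeasurableSpace α] {Q : Measure α} {h : α → ℝ} {s t : ℝ}

/-- The `ψ₂`-norm of `h` under `Q` is at most `t > 0`. -/
structure IsPsi2Bound (Q : Measure α) (h : α → ℝ) (t : ℝ) : Prop where
  pos : 0 < t
  lintegral_le : ∫⁻ x, ENNReal.ofReal (Real.exp (h x ^ 2 / t ^ 2)) ∂Q ≤ 2

theorem IsPsi2Bound.of_psi2Norm_lt {Q : Measure ℝ} {h : ℝ → ℝ}
    (ht : psi2Norm Q h < ENNReal.ofReal t) : IsPsi2Bound Q h t := by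
  have hpos : 0 < t := ENNReal.ofReal_pos.1 (zero_le.trans_lt ht)
  refine ⟨hpos, ?_⟩
  simp only [psi2Norm, iInf_lt_iff] at ht
  obtain ⟨r, hr, hle, hrt⟩ := ht
  refine (lintegral_mono fun x => ENNReal.ofReal_le_ofReal (Real.exp_le_exp.2 ?_)).trans hle
  have : r ≤ t := ((ENNReal.ofReal_lt_ofReal_iff hpos).1 hrt).le
  gcongr

theorem IsPsi2Bound.lintegral_sq_le (hb : IsPsi2Bound Q h t) :
    ∫⁻ x, ENNReal.ofReal (h x ^ 2) ∂Q ≤ ENNReal.ofReal (t ^ 2) * 2 := by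
  have ht := hb.pos
  refine le_trans ?_ (mul_le_mul_right hb.lintegral_le _)
  rw [← lintegral_const_mul' _ _ ENNReal.ofReal_ne_top]
  refine lintegral_mono fun x => ?_
  rw [← ENNReal.ofReal_mul (by positivity)]
  refine ENNReal.ofReal_le_ofReal ?_
  calc h x ^ 2 = t ^ 2 * (h x ^ 2 / t ^ 2) := by field_simp
    _ ≤ t ^ 2 * Real.exp (h x ^ 2 / t ^ 2) := by
      gcongr
      linarith [Real.add_one_le_exp (h x ^ 2 / t ^ 2)]

theorem ae_eq_zero_of_psi2Norm_eq_zero {Q : Measure ℝ} {h : ℝ → ℝ} (hh : AEMeasurable h Q)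
    (hQ : psi2Norm Q h = 0) : ∀ᵐ x ∂Q, h x = 0 := by
  have hsq : ∫⁻ x, ENNReal.ofReal (h x ^ 2) ∂Q = 0 := by
    refine nonpos_iff_eq_zero.1 (ENNReal.le_of_forall_pos_le_add fun ε hε _ => ?_)
    have hroot : (0 : ℝ) < √(ε / 2) := Real.sqrt_pos.2 (by positivity)
    have hb : IsPsi2Bound Q h √(ε / 2) := .of_psi2Norm_lt (by rwa [hQ, ENNReal.ofReal_pos])
    refine hb.lintegral_sq_le.trans_eq ?_
    rw [Real.sq_sqrt (by positivity), ← ENNReal.ofReal_ofNat 2,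
      ← ENNReal.ofReal_mul (by positivity), div_mul_cancel₀ _ two_ne_zero,
      ENNReal.ofReal_coe_nnreal, zero_add]
  rw [lintegral_eq_zero_iff' (by fun_prop)] at hsq
  filter_upwards [hsq] with x hx
  exact pow_eq_zero_iff two_ne_zero |>.1
    (le_antisymm (ENNReal.ofReal_eq_zero.1 hx) (sq_nonneg _))

theorem IsPsi2Bound.integrable_exp_sq_div (hb : IsPsi2Bound Q h t) (hh : AEMeasurable h Q) :
    Integrable (fun x => Real.exp (h x ^ 2 / t ^ 2)) Q := by
  refine ⟨(by fun_prop : AEMeasurable _ Q).aestronglyMeasurable, ?_⟩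
  rw [hasFiniteIntegral_iff_ofReal (Eventually.of_forall fun x => (Real.exp_pos _).le)]
  exact hb.lintegral_le.trans_lt ENNReal.ofNat_lt_top

theorem IsPsi2Bound.integrable_exp_mul (hb : IsPsi2Bound Q h t) (hh : AEMeasurable h Q) (s : ℝ) :
    Integrable (fun x => Real.exp (s * h x)) Q := by
  have ht := hb.pos
  refine ((hb.integrable_exp_sq_div hh).const_mul (Real.exp ((s * t) ^ 2))).mono'
    (by fun_prop : AEMeasurable _ Q).aestronglyMeasurable (Eventually.of_forall fun x => ?_)
  rw [Real.norm_of_nonneg (Real.exp_pos _).le, ← Real.exp_add, Real.exp_le_exp, ← div_pow]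
  have hprod : s * h x = s * t * (h x / t) := by field_simp
  rw [hprod]
  linarith [two_mul_le_add_sq (s * t) (h x / t), sq_nonneg (s * t), sq_nonneg (h x / t)]

theorem IsPsi2Bound.integrableExpSet_eq_univ (hb : IsPsi2Bound Q h t) (hh : AEMeasurable h Q) :
    integrableExpSet h Q = Set.univ :=
  Set.eq_univ_of_forall (hb.integrable_exp_mul hh)

theorem IsPsi2Bound.integrable (hb : IsPsi2Bound Q h t) (hh : AEMeasurable h Q) :
    Integrable h Q := by
  simpa using integrable_pow_of_mem_interior_integrableExpSet
    (by simp [hb.integrableExpSet_eq_univ hh] : (0 : ℝ) ∈ interior (integrableExpSet h Q)) 1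

theorem exp_le_add_exp_sq (x : ℝ) : Real.exp x ≤ x + Real.exp (x ^ 2) := by
  have hexp := Real.add_one_le_exp (x ^ 2)
  rcases le_or_gt |x| 1 with hx | hx
  · linarith [(abs_le.1 (Real.abs_exp_sub_one_sub_id_le hx)).2]
  rcases lt_abs.1 hx with hx | hx
  · linarith [Real.exp_le_exp.2 (by nlinarith : x ≤ x ^ 2)]
  · nlinarith [Real.exp_le_one_iff.2 (by linarith : x ≤ 0)]

theorem exp_mul_le_one_sub_add_mul_exp {θ : ℝ} (hθ : θ ∈ Set.Icc 0 1) (x : ℝ) :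
    Real.exp (θ * x) ≤ 1 - θ + θ * Real.exp x := by
  simpa using convexOn_exp.2 (Set.mem_univ 0) (Set.mem_univ x) (sub_nonneg.2 hθ.2) hθ.1 (by ring)

theorem IsPsi2Bound.mgf_le [IsProbabilityMeasure Q] (hb : IsPsi2Bound Q h t)
    (hh : AEMeasurable h Q) (hmean : ∫ x, h x ∂Q = 0) (hs : (s * t) ^ 2 ≤ 1) :
    mgf h Q s ≤ 1 + (s * t) ^ 2 := by
  have ht := hb.pos
  set θ := (s * t) ^ 2 with hθ
  have hexpsq := hb.integrable_exp_sq_div hh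
  have hint : Integrable (fun x => 1 - θ + θ * Real.exp (h x ^ 2 / t ^ 2)) Q :=
    (integrable_const _).add (hexpsq.const_mul θ)
  have hle_two : ∫ x, Real.exp (h x ^ 2 / t ^ 2) ∂Q ≤ 2 := by
    rw [integral_eq_lintegral_of_nonneg_ae (Eventually.of_forall fun x => (Real.exp_pos _).le)
      hexpsq.aestronglyMeasurable]
    exact ENNReal.toReal_le_of_le_ofReal zero_le_two (by simpa using hb.lintegral_le)
  have hsq (x : α) : (s * h x) ^ 2 = θ * (h x ^ 2 / t ^ 2) := by
    rw [hθ]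
    field_simp
  calc mgf h Q s
      ≤ ∫ x, (s * h x + (1 - θ + θ * Real.exp (h x ^ 2 / t ^ 2))) ∂Q :=
        integral_mono (hb.integrable_exp_mul hh s) (((hb.integrable hh).const_mul s).add hint)
          fun x => (exp_le_add_exp_sq _).trans
            (add_le_add_right (hsq x ▸ exp_mul_le_one_sub_add_mul_exp ⟨sq_nonneg _, hs⟩ _) _)
    _ = 1 - θ + θ * ∫ x, Real.exp (h x ^ 2 / t ^ 2) ∂Q := by
        rw [integral_add ((hb.integrable hh).const_mul s) hint,
          integral_add (integrable_const _) (hexpsq.const_mul θ), integral_const_mul,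
          integral_const_mul, hmean]
        simp
    _ ≤ 1 + θ := by linarith [mul_le_mul_of_nonneg_left hle_two (sq_nonneg (s * t))]

theorem IsPsi2Bound.lintegral_exp_mul_le [IsProbabilityMeasure Q] (hb : IsPsi2Bound Q h t)
    (hh : AEMeasurable h Q) (hmean : ∫ x, h x ∂Q = 0) (hs : (s * t) ^ 2 ≤ 1) :
    ∫⁻ x, ENNReal.ofReal (Real.exp (s * h x)) ∂Q ≤ ENNReal.ofReal (1 + (s * t) ^ 2) := by
  rw [← ofReal_integral_eq_lintegral_ofReal (hb.integrable_exp_mul hh s)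
    (Eventually.of_forall fun x => (Real.exp_pos _).le)]
  exact ENNReal.ofReal_le_ofReal (hb.mgf_le hh hmean hs)

end SubGaussian

section OutcomeLaw

variable {ν : Measure ℝ} {A : Set ℝ} {f : ℝ → ℝ → ℝ}

namespace IsDensityFamily

theorem integrable (hf : IsDensityFamily ν A f) (y : ℝ) :
    Integrable (fun x => f x y) (ν.restrict A) :=
  not_imp_comm.1 integral_undef (by simp [hf.integral_eq_one y])

theorem isProbabilityMeasure_outcomeLaw (hf : IsDensityFamily ν A f) (y : ℝ) :
    IsProbabilityMeasure (outcomeLaw ν A f y) := by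
  have hnonneg : 0 ≤ᵐ[ν.restrict A] fun x => f x y := by
    filter_upwards [ae_restrict_mem hf.measurableSet] with x hx using hf.nonneg x hx y
  refine ⟨?_⟩
  rw [outcomeLaw, withDensity_apply _ MeasurableSet.univ, Measure.restrict_univ,
    ← ofReal_integral_eq_lintegral_ofReal (hf.integrable y) hnonneg, hf.integral_eq_one y,
    ENNReal.ofReal_one]

theorem ae_mem (hf : IsDensityFamily ν A f) (y : ℝ) : ∀ᵐ x ∂outcomeLaw ν A f y, x ∈ A :=
  (withDensity_absolutelyContinuous _ _).ae_le (ae_restrict_mem hf.measurableSet)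

theorem integral_outcomeLaw (hf : IsDensityFamily ν A f) (y : ℝ) (φ : ℝ → ℝ) :
    ∫ x, φ x ∂outcomeLaw ν A f y = ∫ x in A, f x y * φ x ∂ν := by
  rw [outcomeLaw, integral_withDensity_eq_integral_toReal_smul₀
    (hf.integrable y).aemeasurable.ennreal_ofReal (by simp)]
  refine setIntegral_congr_fun hf.measurableSet fun x hx => ?_
  simp [ENNReal.toReal_ofReal (hf.nonneg x hx y)]

theorem integrable_outcomeLaw_iff (hf : IsDensityFamily ν A f) (y : ℝ) (φ : ℝ → ℝ) :
    Integrable φ (outcomeLaw ν A f y) ↔ Integrable (fun x => f x y * φ x) (ν.restrict A) := by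
  rw [outcomeLaw, integrable_withDensity_iff_integrable_smul₀'
    (hf.integrable y).aemeasurable.ennreal_ofReal (by simp)]
  refine integrable_congr ?_
  filter_upwards [ae_restrict_mem hf.measurableSet] with x hx
  simp [ENNReal.toReal_ofReal (hf.nonneg x hx y)]

theorem aemeasurable_score (hf : IsDensityFamily ν A f) (hconc : StrictlyLogConcave A f)
    (y : ℝ) : AEMeasurable (fun x => score f x y) (outcomeLaw ν A f y) := by
  refine AEMeasurable.mono_ac ?_ (withDensity_absolutelyContinuous _ _)
  have hmeas (z : ℝ) : AEMeasurable (fun x => f x z) (ν.restrict A) :=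
    (hf.integrable z).aemeasurable
  have hlim : Tendsto (fun k : ℕ => 1 / ((k : ℝ) + 1)) atTop (𝓝[≠] 0) :=
    tendsto_nhdsWithin_iff.2 ⟨tendsto_one_div_add_atTop_nhds_zero_nat,
      Eventually.of_forall fun k => ne_of_gt (by positivity)⟩
  refine aemeasurable_of_tendsto_metrizable_ae atTop (f := fun (k : ℕ) x =>
    (1 / ((k : ℝ) + 1))⁻¹ • (Real.log (f x (y + 1 / ((k : ℝ) + 1))) - Real.log (f x y)))
    (fun k => ((hmeas _).log.sub (hmeas _).log).const_smul (1 / ((k : ℝ) + 1))⁻¹) ?_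
  filter_upwards [ae_restrict_mem hf.measurableSet] with x hx
  exact (hasDerivAt_iff_tendsto_slope_zero.1 (hconc.hasDerivAt_log hx y)).comp hlim

/-- By the tangent line bound `f(x; y + s) ≤ f(x; y) exp(s g(x; y))`, the moment generating function
of the score is smallest at `0`, so its derivative there, the mean of the score, vanishes. -/
theorem integral_score_eq_zero (hf : IsDensityFamily ν A f) (hconc : StrictlyLogConcave A f)
    {y t : ℝ} (hb : IsPsi2Bound (outcomeLaw ν A f y) (fun x => score f x y) t) :
    ∫ x, score f x y ∂outcomeLaw ν A f y = 0 := by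
  have := hf.isProbabilityMeasure_outcomeLaw y
  have hmeas := hf.aemeasurable_score hconc y
  have hmin : IsLocalMin (mgf (fun x => score f x y) (outcomeLaw ν A f y)) 0 := by
    refine Eventually.of_forall fun s => ?_
    rw [mgf_zero, mgf, hf.integral_outcomeLaw, ← hf.integral_eq_one (y + s)]
    exact setIntegral_mono_on (hf.integrable _)
      ((hf.integrable_outcomeLaw_iff y _).1 (hb.integrable_exp_mul hmeas s)) hf.measurableSet
      fun x hx => hconc.le_mul_exp hx y s
  simpa using hmin.hasDerivAt_eq_zero
    (hasDerivAt_mgf (by simp [hb.integrableExpSet_eq_univ hmeas]))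

theorem psi2Norm_score_ne_zero (hf : IsDensityFamily ν A f) (hconc : StrictlyLogConcave A f)
    (y : ℝ) : psi2Norm (outcomeLaw ν A f y) (fun x => score f x y) ≠ 0 := by
  intro hnorm
  have hscore : ∀ᵐ x ∂ν.restrict A, score f x y = 0 := by
    have hzero := ae_eq_zero_of_psi2Norm_eq_zero (hf.aemeasurable_score hconc y) hnorm
    rw [outcomeLaw, ae_withDensity_iff' (hf.integrable y).aemeasurable.ennreal_ofReal] at hzero
    filter_upwards [hzero, ae_restrict_mem hf.measurableSet] with x hx hxA
    exact hx (by simpa using hconc.pos x hxA y)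
  have hlt : ∀ᵐ x ∂ν.restrict A, 0 < f x y - f x (y + 1) := by
    filter_upwards [hscore, ae_restrict_mem hf.measurableSet] with x hx hxA
    simpa [hx] using hconc.lt_mul_exp hxA y one_ne_zero
  have hintegral : ∫ x in A, (f x y - f x (y + 1)) ∂ν = 0 := by
    rw [integral_sub (hf.integrable _) (hf.integrable _), hf.integral_eq_one, hf.integral_eq_one,
      sub_self]
  rw [integral_eq_zero_iff_of_nonneg_ae (hlt.mono fun x hx => hx.le)
    ((hf.integrable _).sub (hf.integrable _))] at hintegral
  have hnull : ν.restrict A = 0 := by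
    refine ae_eq_bot.1 (eventually_false_iff_eq_bot.1 ?_)
    filter_upwards [hlt, hintegral] with x hx hx' using hx.ne' hx'
  simpa [hnull] using hf.integral_eq_one y

end IsDensityFamily

end OutcomeLaw

section Independence

variable {Ω : Type*} [MeasurableSpace Ω] {P : Measure Ω}
  {ν : Measure ℝ} {A : Set ℝ} {f : ℝ → ℝ → ℝ} {T n : ℕ} {p : ℝ} {u : Fin n → ℝ}
  {N : Pair n → Ω → ℕ} {X : Pair n → Fin T → Ω → ℝ}

theorem sum_choose_mul_pow {m : ℝ} (hp : p ∈ Set.Icc (0 : ℝ) 1) (hm : 0 ≤ m) :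
    ∑ k : Fin (T + 1), ENNReal.ofReal ((T.choose k : ℝ) * p ^ (k : ℕ) * (1 - p) ^ (T - k)) *
      ENNReal.ofReal m ^ (k : ℕ) = ENNReal.ofReal ((1 - p + p * m) ^ T) := by
  have hp' : 0 ≤ 1 - p := sub_nonneg.2 hp.2
  have hweight (k : Fin (T + 1)) : 0 ≤ (T.choose k : ℝ) * p ^ (k : ℕ) * (1 - p) ^ (T - k) :=
    mul_nonneg (mul_nonneg (Nat.cast_nonneg _) (pow_nonneg hp.1 _)) (pow_nonneg hp' _)
  rw [add_comm (1 - p), add_pow, Finset.sum_range, ENNReal.ofReal_sum_of_nonneg fun k _ =>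
    mul_nonneg (mul_nonneg (pow_nonneg (mul_nonneg hp.1 hm) _) (pow_nonneg hp' _))
      (Nat.cast_nonneg _)]
  refine Finset.sum_congr rfl fun k _ => ?_
  rw [← ENNReal.ofReal_pow hm, ← ENNReal.ofReal_mul (hweight k), mul_pow]
  congr 1
  ring

/-- The factor at an index of `IsComparisonData.indep` of the product of `h` over the observed
outcomes, on the event that each pair `e` is compared `k e` times. -/
def stratumFactor (h : Pair n → ℝ → ℝ≥0∞) (k : Pair n → Fin (T + 1)) :
    Pair n × Option (Fin T) → ℝ → ℝ≥0∞
  | (e, none) => Set.indicator {((k e : ℕ) : ℝ)} 1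
  | (e, some t) => if t.val < k e then h e else 1

theorem measurable_stratumFactor {h : Pair n → ℝ → ℝ≥0∞} (hh : ∀ e, Measurable (h e))
    (k : Pair n → Fin (T + 1)) : ∀ q, Measurable (stratumFactor h k q)
  | (_, none) => measurable_one.indicator (measurableSet_singleton _)
  | (e, some t) => by
    by_cases ht : t.val < k e
    · simpa [stratumFactor, ht] using hh e
    · simpa [stratumFactor, ht] using measurable_one

namespace IsComparisonData

theorem measurable_data (hdata : IsComparisonData P ν A f T p u N X) :
    ∀ q : Pair n × Option (Fin T),
      Measurable fun ω => q.2.elim (N q.1 ω : ℝ) fun t => X q.1 t ω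
  | (e, none) => (measurable_of_countable (Nat.cast : ℕ → ℝ)).comp (hdata.measurable_count e)
  | (e, some t) => hdata.measurable_outcome e t

theorem measurable_stratumFactor_data (hdata : IsComparisonData P ν A f T p u N X)
    {h : Pair n → ℝ → ℝ≥0∞} (hh : ∀ e, Measurable (h e)) (k : Pair n → Fin (T + 1))
    (q : Pair n × Option (Fin T)) :
    Measurable fun ω => stratumFactor h k q (q.2.elim (N q.1 ω : ℝ) fun t => X q.1 t ω) :=
  (measurable_stratumFactor hh k q).comp (hdata.measurable_data q)

theorem ae_count_le (hdata : IsComparisonData P ν A f T p u N X) :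
    ∀ᵐ ω ∂P, ∀ e, N e ω ≤ T := by
  have hne (e : Pair n) (k : ℕ) : ∀ᵐ ω ∂P, T < k → N e ω ≠ k := by
    by_cases hk : T < k
    · simpa [ae_iff, hk, Nat.choose_eq_zero_of_lt hk] using hdata.count_law e k
    · simp [hk]
  filter_upwards [ae_all_iff.2 fun e => ae_all_iff.2 (hne e)] with ω hω e
  exact not_lt.1 fun hlt => hω e _ hlt rfl

theorem ae_prod_observed_eq_sum (hdata : IsComparisonData P ν A f T p u N X)
    (h : Pair n → ℝ → ℝ≥0∞) :
    ∀ᵐ ω ∂P, ∏ e, ∏ t : Fin T with t.val < N e ω, h e (X e t ω) =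
      ∑ k, ∏ q : Pair n × Option (Fin T),
        stratumFactor h k q (q.2.elim (N q.1 ω : ℝ) fun t => X q.1 t ω) := by
  filter_upwards [hdata.ae_count_le] with ω hω
  rw [Finset.sum_eq_single (fun e => ⟨N e ω, Nat.lt_succ_of_le (hω e)⟩)]
  · simp [Fintype.prod_prod_type, Fintype.prod_option, stratumFactor, Finset.prod_filter,
      ite_apply]
  · intro k _ hk
    obtain ⟨e, he⟩ := Function.ne_iff.1 hk
    have hcount : N e ω ≠ k e := fun heq => he (Fin.ext heq.symm)
    exact Finset.prod_eq_zero (Finset.mem_univ (e, none)) (by simp [stratumFactor, hcount])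
  · simp

theorem lintegral_stratumFactor_none (hdata : IsComparisonData P ν A f T p u N X)
    (h : Pair n → ℝ → ℝ≥0∞) (k : Pair n → Fin (T + 1)) (e : Pair n) :
    ∫⁻ ω, stratumFactor h k (e, none) (N e ω : ℝ) ∂P =
      ENNReal.ofReal ((T.choose (k e) : ℝ) * p ^ (k e : ℕ) * (1 - p) ^ (T - k e)) := by
  have hind : (fun ω => stratumFactor h k (e, none) (N e ω : ℝ)) =
      Set.indicator {ω | N e ω = k e} 1 := by
    funext ω
    by_cases hω : N e ω = k e <;> simp [stratumFactor, hω]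
  rw [← hdata.count_law e (k e), hind]
  exact lintegral_indicator_one (hdata.measurable_count e (measurableSet_singleton _))

theorem prod_lintegral_stratumFactor_some_le [IsProbabilityMeasure P]
    (hdata : IsComparisonData P ν A f T p u N X) {h : Pair n → ℝ → ℝ≥0∞} {e : Pair n}
    (hh : Measurable (h e)) {m : ℝ≥0∞}
    (hle : ∫⁻ x, h e x ∂outcomeLaw ν A f (u e.1.1 - u e.1.2) ≤ m) (k : Pair n → Fin (T + 1)) :
    ∏ t, ∫⁻ ω, stratumFactor h k (e, some t) (X e t ω) ∂P ≤ m ^ (k e : ℕ) :=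
  calc ∏ t, ∫⁻ ω, stratumFactor h k (e, some t) (X e t ω) ∂P
      ≤ ∏ t : Fin T, if t.val < k e then m else 1 := by
        refine Finset.prod_le_prod' fun t _ => ?_
        by_cases ht : t.val < k e
        · simp only [stratumFactor, ht, if_true]
          rwa [← lintegral_map hh (hdata.measurable_outcome e t), hdata.outcome_law]
        · simp [stratumFactor, ht]
    _ = m ^ (k e : ℕ) := by
        rw [← Finset.prod_filter, Finset.prod_const, Fin.card_filter_val_lt,
          min_eq_right (Nat.lt_succ_iff.1 (k e).2)]

theorem lintegral_prod_stratumFactor_le [IsProbabilityMeasure P]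
    (hdata : IsComparisonData P ν A f T p u N X) {h : Pair n → ℝ → ℝ≥0∞}
    (hh : ∀ e, Measurable (h e)) {m : Pair n → ℝ≥0∞}
    (hle : ∀ e, ∫⁻ x, h e x ∂outcomeLaw ν A f (u e.1.1 - u e.1.2) ≤ m e)
    (k : Pair n → Fin (T + 1)) :
    ∫⁻ ω, ∏ q : Pair n × Option (Fin T),
        stratumFactor h k q (q.2.elim (N q.1 ω : ℝ) fun t => X q.1 t ω) ∂P ≤
      ∏ e, ENNReal.ofReal ((T.choose (k e) : ℝ) * p ^ (k e : ℕ) * (1 - p) ^ (T - k e)) *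
        m e ^ (k e : ℕ) := by
  rw [lintegral_prod_eq_prod_lintegral_of_indepFun Finset.univ (fun q ω =>
      stratumFactor h k q (q.2.elim (N q.1 ω : ℝ) fun t => X q.1 t ω))
    (hdata.indep.comp _ (measurable_stratumFactor hh k))
    (hdata.measurable_stratumFactor_data hh k), Fintype.prod_prod_type]
  simp only [Fintype.prod_option]
  gcongr with e
  · exact (hdata.lintegral_stratumFactor_none h k e).le
  · exact hdata.prod_lintegral_stratumFactor_some_le (hh e) (hle e) k

/-- An exponential moment bound for the observed outcomes, by conditioning on the numbers of
comparisons. -/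
theorem lintegral_prod_observed_le [IsProbabilityMeasure P]
    (hdata : IsComparisonData P ν A f T p u N X) (hp : p ∈ Set.Icc (0 : ℝ) 1)
    {h : Pair n → ℝ → ℝ≥0∞} (hh : ∀ e, Measurable (h e)) {m : Pair n → ℝ} (hm : ∀ e, 0 ≤ m e)
    (hle : ∀ e, ∫⁻ x, h e x ∂outcomeLaw ν A f (u e.1.1 - u e.1.2) ≤ ENNReal.ofReal (m e)) :
    ∫⁻ ω, ∏ e, ∏ t : Fin T with t.val < N e ω, h e (X e t ω) ∂P ≤
      ∏ e, ENNReal.ofReal ((1 - p + p * m e) ^ T) := by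
  classical
  rw [lintegral_congr_ae (hdata.ae_prod_observed_eq_sum h), lintegral_finsetSum _ fun k _ =>
    Finset.measurable_fun_prod _ fun q _ => hdata.measurable_stratumFactor_data hh k q]
  refine (Finset.sum_le_sum fun k _ => hdata.lintegral_prod_stratumFactor_le hh hle k).trans_eq ?_
  simp_rw [← sum_choose_mul_pow hp (hm _), Finset.prod_univ_sum, Fintype.piFinset_univ]

theorem measurable_prod_observed (hdata : IsComparisonData P ν A f T p u N X)
    {h : Pair n → ℝ → ℝ≥0∞} (hh : ∀ e, Measurable (h e)) :
    Measurable fun ω => ∏ e, ∏ t : Fin T with t.val < N e ω, h e (X e t ω) := by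
  simp only [Finset.prod_filter]
  refine Finset.measurable_fun_prod _ fun e _ => Finset.measurable_fun_prod _ fun t _ => ?_
  exact Measurable.ite (hdata.measurable_count e (measurableSet_Ioi (a := t.val)))
    ((hh e).comp (hdata.measurable_outcome e t)) measurable_const

theorem measure_exp_le_prod_observed_le [IsProbabilityMeasure P]
    (hdata : IsComparisonData P ν A f T p u N X) (hp : p ∈ Set.Icc (0 : ℝ) 1)
    {h : Pair n → ℝ → ℝ≥0∞} (hh : ∀ e, Measurable (h e)) {r : Pair n → ℝ} (hr : ∀ e, 0 ≤ 1 + r e)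
    (hle : ∀ e, ∫⁻ x, h e x ∂outcomeLaw ν A f (u e.1.1 - u e.1.2) ≤ ENNReal.ofReal (1 + r e))
    (b : ℝ) :
    P {ω | ENNReal.ofReal (Real.exp b) ≤ ∏ e, ∏ t : Fin T with t.val < N e ω, h e (X e t ω)} ≤
      ENNReal.ofReal (Real.exp (T * p * ∑ e, r e - b)) := by
  refine (meas_ge_le_lintegral_div (hdata.measurable_prod_observed hh).aemeasurable
    (by simpa using Real.exp_pos b) ENNReal.ofReal_ne_top).trans ?_
  rw [Real.exp_sub, ENNReal.ofReal_div_of_pos (Real.exp_pos b)]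
  gcongr
  refine (hdata.lintegral_prod_observed_le hp hh hr hle).trans ?_
  have hbase (e : Pair n) : 0 ≤ 1 - p + p * (1 + r e) :=
    add_nonneg (sub_nonneg.2 hp.2) (mul_nonneg hp.1 (hr e))
  rw [← ENNReal.ofReal_prod_of_nonneg fun e _ => pow_nonneg (hbase e) T, Finset.mul_sum,
    Real.exp_sum]
  refine ENNReal.ofReal_le_ofReal (Finset.prod_le_prod (fun e _ => pow_nonneg (hbase e) T)
    fun e _ => ?_)
  rw [mul_assoc, Real.exp_nat_mul]
  refine pow_le_pow_left₀ (hbase e) ?_ T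
  linarith [Real.add_one_le_exp (p * r e)]

theorem ae_forall_outcome (hdata : IsComparisonData P ν A f T p u N X)
    {φ : Pair n → ℝ → Prop} (hφ : ∀ e, ∀ᵐ x ∂outcomeLaw ν A f (u e.1.1 - u e.1.2), φ e x) :
    ∀ᵐ ω ∂P, ∀ e t, φ e (X e t ω) :=
  ae_all_iff.2 fun e => ae_all_iff.2 fun t =>
    ae_of_ae_map (hdata.measurable_outcome e t).aemeasurable (hdata.outcome_law e t ▸ hφ e)

/-- Chernoff's bound for sums over the observed outcomes. -/
theorem measure_le_sum_observed_le [IsProbabilityMeasure P]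
    (hdata : IsComparisonData P ν A f T p u N X) (hp : p ∈ Set.Icc (0 : ℝ) 1)
    {g : Pair n → ℝ → ℝ}
    (hg : ∀ e, AEMeasurable (g e) (outcomeLaw ν A f (u e.1.1 - u e.1.2)))
    {r : Pair n → ℝ} (hr : ∀ e, 0 ≤ 1 + r e)
    (hle : ∀ e, ∫⁻ x, ENNReal.ofReal (Real.exp (g e x)) ∂outcomeLaw ν A f (u e.1.1 - u e.1.2) ≤
      ENNReal.ofReal (1 + r e)) (b : ℝ) :
    P {ω | b ≤ ∑ e, ∑ t : Fin T with t.val < N e ω, g e (X e t ω)} ≤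
      ENNReal.ofReal (Real.exp (T * p * ∑ e, r e - b)) := by
  refine le_trans (measure_mono_ae ?_) (hdata.measure_exp_le_prod_observed_le hp
    (h := fun e x => ENNReal.ofReal (Real.exp ((hg e).mk (g e) x)))
    (fun e => (hg e).measurable_mk.exp.ennreal_ofReal) hr (fun e => ?_) b)
  · filter_upwards [hdata.ae_forall_outcome fun e => (hg e).ae_eq_mk] with ω hω (hb : b ≤ _)
    change ENNReal.ofReal (Real.exp b) ≤ _
    simp_rw [← hω]
    simpa [← ENNReal.ofReal_prod_of_nonneg, Finset.prod_nonneg, Real.exp_nonneg, ← Real.exp_sum]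
      using hb
  · refine (lintegral_congr_ae ?_).trans_le (hle e)
    filter_upwards [(hg e).ae_eq_mk] with x hx
    rw [hx]

end IsComparisonData

end Independence

section Counting

variable {n : ℕ}

theorem cutSign_sq_le_one (U : Finset (Fin n)) (e : Pair n) : cutSign U e ^ 2 ≤ 1 := by
  unfold cutSign
  split_ifs <;> norm_num

theorem cutSign_singleton_sq (i : Fin n) (e : Pair n) :
    cutSign {i} e ^ 2 = if e.1.1 = i ∨ e.1.2 = i then 1 else 0 := by
  have hne := e.2.ne
  grind [cutSign]

theorem sum_cutSign_singleton_sq_le (i : Fin n) : ∑ e : Pair n, cutSign {i} e ^ 2 ≤ n := by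
  simp only [cutSign_singleton_sq, Finset.sum_boole]
  suffices hcard : (Finset.univ.filter fun e : Pair n => e.1.1 = i ∨ e.1.2 = i).card ≤
      (Finset.univ : Finset (Fin n)).card by
    rw [Finset.card_univ, Fintype.card_fin] at hcard
    exact_mod_cast hcard
  refine Finset.card_le_card_of_injOn (fun e => if e.1.1 = i then e.1.2 else e.1.1)
    (fun _ _ => Finset.mem_coe.2 (Finset.mem_univ _)) ?_
  rintro ⟨⟨a, b⟩, hab : a < b⟩ he ⟨⟨c, d⟩, hcd : c < d⟩ he'
  simp only [Finset.coe_filter, Finset.mem_univ, true_and, Set.mem_ofPred_eq] at he he'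
  simp only [Subtype.mk.injEq, Prod.mk.injEq]
  grind

theorem card_mul_card_le_card_pairsBetween {S W : Finset (Fin n)} (hSW : Disjoint S W) :
    S.card * W.card ≤ (pairsBetween S W).card := by
  rw [← Finset.card_product]
  refine Finset.card_le_card_of_surjOn
    (fun e => if e.1.1 ∈ S then (e.1.1, e.1.2) else (e.1.2, e.1.1)) ?_
  rintro ⟨a, b⟩ hab
  simp only [Finset.coe_product, Set.mem_prod, Finset.mem_coe] at hab
  rcases lt_or_gt_of_ne (hSW.forall_ne_finset hab.1 hab.2) with hlt | hlt
  · exact ⟨⟨(a, b), hlt⟩, by simp [pairsBetween, hab], by simp [hab]⟩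
  · exact ⟨⟨(b, a), hlt⟩, by simp [pairsBetween, hab],
      by simp [Finset.disjoint_right.1 hSW hab.2]⟩

theorem add_one_pow_le_exp_mul {x : ℝ} (hx : 0 ≤ x) (n : ℕ) : (x + 1) ^ n ≤ Real.exp (n * x) := by
  rw [Real.exp_nat_mul]
  exact pow_le_pow_left₀ (by positivity) (Real.add_one_le_exp x) n

theorem sum_pow_card (x : ℝ) : ∑ S : Finset (Fin n), x ^ S.card = (x + 1) ^ n := by
  simpa using Fintype.sum_pow_mul_eq_add_pow (Fin n) x 1

theorem sum_nonempty_pow_card_mul_pow_card_le {x y : ℝ} (hx : 0 ≤ x) (hnx : n * x ≤ 1)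
    (hy : 0 ≤ y) (hny : n * y ≤ 1) :
    ∑ s : Finset (Fin n) × Finset (Fin n) with s.1.Nonempty, x ^ s.1.card * y ^ s.2.card ≤
      6 * (n * x) := by
  have hfilter : (Finset.univ.filter fun s : Finset (Fin n) × Finset (Fin n) => s.1.Nonempty) =
      Finset.univ.erase ∅ ×ˢ Finset.univ := by
    ext s
    simp [Finset.nonempty_iff_ne_empty]
  have hpowx : (x + 1) ^ n - 1 ≤ 2 * (n * x) := by
    have hexp := (abs_le.1 (Real.abs_exp_sub_one_sub_id_le
      (by rwa [abs_of_nonneg (by positivity)] : |n * x| ≤ 1))).2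
    nlinarith [add_one_pow_le_exp_mul hx n, (by positivity : 0 ≤ n * x)]
  have hpowy : (y + 1) ^ n ≤ 3 := by
    linarith [add_one_pow_le_exp_mul hy n, Real.exp_le_exp.2 hny, Real.exp_one_lt_d9]
  calc ∑ s : Finset (Fin n) × Finset (Fin n) with s.1.Nonempty, x ^ s.1.card * y ^ s.2.card
      = ((x + 1) ^ n - 1) * (y + 1) ^ n := by
        rw [hfilter, Finset.sum_product]
        dsimp only
        rw [← Finset.sum_mul_sum, Finset.sum_erase_eq_sub (Finset.mem_univ _), sum_pow_card,
          sum_pow_card, Finset.card_empty, pow_zero]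
    _ ≤ 2 * (n * x) * 3 := mul_le_mul hpowx hpowy (by positivity) (by positivity)
    _ = 6 * (n * x) := by ring

theorem sum_exp_neg_mul_card_le {R q : ℝ} (hsmall : n * Real.exp (R * Real.log n - q) ≤ 1) :
    ∑ s : Finset (Fin n) × Finset (Fin n) with s.1.Nonempty ∧ (s.2.card : ℝ) ≤ R * s.1.card,
      Real.exp (-(q * s.1.card)) ≤ 6 * (n * Real.exp (R * Real.log n - q)) := by
  have hn : n * Real.exp (-Real.log n) ≤ 1 := by
    rcases n.eq_zero_or_pos with rfl | hpos
    · simp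
    · rw [Real.exp_neg, Real.exp_log (Nat.cast_pos.2 hpos), mul_inv_cancel₀ (by positivity)]
  refine le_trans ?_ (sum_nonempty_pow_card_mul_pow_card_le (Real.exp_pos _).le hsmall
    (Real.exp_pos _).le hn)
  rw [← Finset.filter_filter]
  refine (Finset.sum_le_sum fun s hs => ?_).trans
    (Finset.sum_le_sum_of_subset_of_nonneg (Finset.filter_subset _ _) fun s _ _ => by positivity)
  rw [← Real.exp_nat_mul, ← Real.exp_nat_mul, ← Real.exp_add, Real.exp_le_exp]
  linarith [mul_le_mul_of_nonneg_right (Finset.mem_filter.1 hs).2 (Real.log_natCast_nonneg n)]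

end Counting

section Tails

variable {Ω : Type*} [MeasurableSpace Ω] {P : Measure Ω} [IsProbabilityMeasure P]
  {ν : Measure ℝ} {A : Set ℝ} {f : ℝ → ℝ → ℝ} {T n : ℕ} {p : ℝ} {u : Fin n → ℝ}
  {N : Pair n → Ω → ℕ} {X : Pair n → Fin T → Ω → ℝ}

namespace IsComparisonData

theorem measure_le_scoreSum_le (hf : IsDensityFamily ν A f) (hconc : StrictlyLogConcave A f)
    (hdata : IsComparisonData P ν A f T p u N X) (hp : p ∈ Set.Icc (0 : ℝ) 1) {s t : ℝ}
    (hb : ∀ e : Pair n, IsPsi2Bound (outcomeLaw ν A f (u e.1.1 - u e.1.2))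
      (fun x => score f x (u e.1.1 - u e.1.2)) t)
    (hs : (s * t) ^ 2 ≤ 1) (i : Fin n) (b : ℝ) :
    P {ω | b ≤ s * scoreSum f (fun e => N e ω) (fun e t => X e t ω) u {i}} ≤
      ENNReal.ofReal (Real.exp (T * p * ((s * t) ^ 2 * n) - b)) := by
  have hscore (ω : Ω) : s * scoreSum f (fun e => N e ω) (fun e t => X e t ω) u {i} =
      ∑ e, ∑ t : Fin T with t.val < N e ω,
        s * cutSign {i} e * score f (X e t ω) (u e.1.1 - u e.1.2) := by
    simp only [scoreSum, Finset.mul_sum, mul_assoc]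
  have hvar (e : Pair n) : (s * cutSign {i} e * t) ^ 2 = (s * t) ^ 2 * cutSign {i} e ^ 2 := by ring
  have hsum : ∑ e, (s * cutSign {i} e * t) ^ 2 ≤ (s * t) ^ 2 * n := by
    simp only [hvar, ← Finset.mul_sum]
    exact mul_le_mul_of_nonneg_left (sum_cutSign_singleton_sq_le i) (sq_nonneg _)
  simp only [hscore]
  refine (hdata.measure_le_sum_observed_le hp (r := fun e => (s * cutSign {i} e * t) ^ 2)
    (g := fun e x => s * cutSign {i} e * score f x (u e.1.1 - u e.1.2))
    (fun e => (hf.aemeasurable_score hconc _).const_mul _) (fun e => by positivity)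
    (fun e => ?_) b).trans (ENNReal.ofReal_le_ofReal (Real.exp_le_exp.2 ?_))
  · have := hf.isProbabilityMeasure_outcomeLaw (u e.1.1 - u e.1.2)
    refine (hb e).lintegral_exp_mul_le (hf.aemeasurable_score hconc _)
      (hf.integral_score_eq_zero hconc (hb e)) ?_
    rw [hvar]
    exact mul_le_one₀ hs (sq_nonneg _) (cutSign_sq_le_one _ e)
  · have hp0 := hp.1
    gcongr

theorem measure_lt_mul_abs_scoreSum_le (hf : IsDensityFamily ν A f)
    (hconc : StrictlyLogConcave A f) (hdata : IsComparisonData P ν A f T p u N X)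
    (hp : p ∈ Set.Icc (0 : ℝ) 1) {s t : ℝ}
    (hb : ∀ e : Pair n, IsPsi2Bound (outcomeLaw ν A f (u e.1.1 - u e.1.2))
      (fun x => score f x (u e.1.1 - u e.1.2)) t)
    (hs : (s * t) ^ 2 ≤ 1) (i : Fin n) (b : ℝ) :
    P {ω | b < s * |scoreSum f (fun e => N e ω) (fun e t => X e t ω) u {i}|} ≤
      ENNReal.ofReal (2 * Real.exp (T * p * ((s * t) ^ 2 * n) - b)) := by
  have hneg := hdata.measure_le_scoreSum_le hf hconc hp hb (s := -s) (by simpa using hs) i b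
  rw [neg_mul, neg_sq] at hneg
  rw [two_mul, ENNReal.ofReal_add (Real.exp_pos _).le (Real.exp_pos _).le]
  refine (measure_mono fun ω hω => ?_).trans ((measure_union_le _ _).trans
    (add_le_add (hdata.measure_le_scoreSum_le hf hconc hp hb hs i b) hneg))
  change b < s * |scoreSum f _ _ u {i}| at hω
  rcases abs_choice (scoreSum f (fun e => N e ω) (fun e t => X e t ω) u {i}) with habs | habs <;>
    rw [habs] at hω
  · exact Or.inl hω.le
  · exact Or.inr (hω.le.trans_eq (by ring))

theorem measure_cutWeight_le (hf : IsDensityFamily ν A f)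
    (hdata : IsComparisonData P ν A f T p u N X) (hp : p ∈ Set.Icc (0 : ℝ) 1) (hT : 1 ≤ T)
    {S W : Finset (Fin n)} (hSW : Disjoint S W) (b : ℝ) :
    P {ω | (cutWeight (count T fun e => N e ω) S W : ℝ) ≤ b} ≤
      ENNReal.ofReal (Real.exp (b - p / 2 * (S.card * W.card))) := by
  have hprob := hf.isProbabilityMeasure_outcomeLaw
  set J : Pair n → ℝ := fun e => if e ∈ pairsBetween S W then 1 else 0 with hJ
  have hweight (M : Pair n → ℕ) : (cutWeight (count T M) S W : ℝ) =
      -∑ e, ∑ t : Fin T with t.val < M e, -J e := by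
    simp [cutWeight, count, hJ]
  have hchernoff := hdata.measure_le_sum_observed_le hp (g := fun e _ => -J e)
    (r := fun e => Real.exp (-J e) - 1) (fun e => aemeasurable_const)
    (fun e => by simpa using (Real.exp_pos _).le) (fun e => by simp) (-b)
  simp only [hweight, neg_le (b := b)]
  refine hchernoff.trans (ENNReal.ofReal_le_ofReal (Real.exp_le_exp.2 ?_))
  have hexp (e : Pair n) : Real.exp (-J e) - 1 ≤ -(1 / 2) * J e := by
    simp only [hJ]
    split_ifs
    · linarith [Real.exp_neg_one_lt_d9]
    · simp
  have hsum : ∑ e, (Real.exp (-J e) - 1) ≤ -(1 / 2) * (S.card * W.card) := by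
    refine (Finset.sum_le_sum fun e _ => hexp e).trans ?_
    have hcard : (S.card * W.card : ℝ) ≤ (pairsBetween S W).card := by
      exact_mod_cast card_mul_card_le_card_pairsBetween hSW
    rw [← Finset.mul_sum, Finset.sum_boole, Finset.filter_univ_mem]
    linarith
  have hTp : p ≤ T * p := le_mul_of_one_le_left hp.1 (Nat.one_le_cast.2 hT)
  have hmul := mul_le_mul_of_nonneg_left hsum (hp.1.trans hTp)
  linarith [mul_le_mul_of_nonneg_right hTp (by positivity : (0 : ℝ) ≤ S.card * W.card)]

theorem measure_cutWeight_compl_le (hf : IsDensityFamily ν A f)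
    (hdata : IsComparisonData P ν A f T p u N X) (hp : p ∈ Set.Icc (0 : ℝ) 1) (hT : 1 ≤ T)
    {S S' : Finset (Fin n)} (hS : S ⊆ S') (hS' : 2 * S'.card ≤ n) :
    P {ω | (cutWeight (count T fun e => N e ω) S S'ᶜ : ℝ) ≤ n * p / 8 * S.card} ≤
      ENNReal.ofReal (Real.exp (-(n * p / 8 * S.card))) := by
  refine (hdata.measure_cutWeight_le hf hp hT
    (disjoint_compl_right.mono_left hS) _).trans
    (ENNReal.ofReal_le_ofReal (Real.exp_le_exp.2 ?_))
  have hcompl : (n : ℝ) ≤ 2 * S'ᶜ.card := by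
    have := S'.card_add_card_compl
    rw [Fintype.card_fin] at this
    exact_mod_cast (by omega : n ≤ 2 * S'ᶜ.card)
  linarith [mul_le_mul_of_nonneg_left hcompl (mul_nonneg hp.1 (Nat.cast_nonneg S.card))]

theorem measure_not_expands_le (hf : IsDensityFamily ν A f)
    (hdata : IsComparisonData P ν A f T p u N X) (hp : p ∈ Set.Icc (0 : ℝ) 1) (hT : 1 ≤ T)
    {R : ℝ} (hsmall : n * Real.exp (R * Real.log n - n * p / 8) ≤ 1) :
    P {ω | ¬Expands (count T fun e => N e ω) R (n * p / 8)} ≤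
      ENNReal.ofReal (6 * (n * Real.exp (R * Real.log n - n * p / 8))) := by
  set F : Finset (Finset (Fin n) × Finset (Fin n)) :=
    {s | s.1.Nonempty ∧ (s.2.card : ℝ) ≤ R * s.1.card}
  have hcover : {ω | ¬Expands (count T fun e => N e ω) R (n * p / 8)} ⊆
      ⋃ s ∈ F, {ω | s.1 ⊆ s.2 ∧ 2 * s.2.card ≤ n ∧
        (cutWeight (count T fun e => N e ω) s.1 s.2ᶜ : ℝ) ≤ n * p / 8 * s.1.card} := by
    intro ω hω
    change ¬Expands _ R _ at hω
    simp only [Expands, not_forall, not_lt] at hω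
    obtain ⟨S, S', hne, hsub, hratio, hhalf, hle⟩ := hω
    exact Set.mem_biUnion (x := (S, S')) (by simp [F, hne, hratio]) ⟨hsub, hhalf, hle⟩
  calc P {ω | ¬Expands (count T fun e => N e ω) R (n * p / 8)}
      ≤ ∑ s ∈ F, ENNReal.ofReal (Real.exp (-(n * p / 8 * s.1.card))) := by
        refine (measure_mono hcover).trans ((measure_biUnion_finset_le _ _).trans
          (Finset.sum_le_sum fun s _ => ?_))
        by_cases hs : s.1 ⊆ s.2 ∧ 2 * s.2.card ≤ n
        · simpa [hs] using hdata.measure_cutWeight_compl_le hf hp hT hs.1 hs.2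
        · simp [← and_assoc, hs]
    _ ≤ ENNReal.ofReal (6 * (n * Real.exp (R * Real.log n - n * p / 8))) := by
        rw [← ENNReal.ofReal_sum_of_nonneg fun _ _ => (Real.exp_pos _).le]
        exact ENNReal.ofReal_le_ofReal (sum_exp_neg_mul_card_le hsmall)

end IsComparisonData

end Tails

section Rate

variable {n : ℕ} {p : ℝ}

/-- The factor of the rate `Delta` that depends only on the comparison graph. -/
def graphRate (n : ℕ) (p : ℝ) : ℝ := √(Real.log n / (n * p)) * (Real.log n / Real.log (n * p))

theorem one_le_log_div_log (hq : 1 < n * p) (hp : p ≤ 1) :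
    1 ≤ Real.log n / Real.log (n * p) :=
  (one_le_div (Real.log_pos hq)).2
    (Real.log_le_log (by linarith) (mul_le_of_le_one_right (Nat.cast_nonneg n) hp))

theorem sqrt_log_div_le_graphRate (hq : 1 < n * p) (hp : p ≤ 1) :
    √(Real.log n / (n * p)) ≤ graphRate n p :=
  le_mul_of_one_le_right (Real.sqrt_nonneg _) (one_le_log_div_log hq hp)

theorem graphRate_pos (hn : 2 ≤ n) (hq : 1 < n * p) : 0 < graphRate n p := by
  have hlog : 0 < Real.log n := Real.log_pos (by exact_mod_cast hn)
  have hlogq := Real.log_pos hq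
  unfold graphRate
  positivity

theorem eventually_log_sq_le : ∀ᶠ x : ℝ in atTop, 4096 * Real.log x ^ 2 ≤ √x := by
  have hlog := (Real.isLittleO_pow_log_id_atTop (n := 4)).bound
    (c := (1 / 4096) ^ 2) (by norm_num)
  filter_upwards [hlog, eventually_ge_atTop 1] with x hx hx1
  simp only [id, Real.norm_eq_abs] at hx
  rw [abs_of_nonneg (by positivity), abs_of_nonneg (by linarith)] at hx
  refine Real.le_sqrt_of_sq_le ?_
  linarith

theorem log_le_sqrt_of_graphRate_le_one (hq : 1 < n * p) (hrate : graphRate n p ≤ 1)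
    (hlog : 4096 * Real.log (n * p) ^ 2 ≤ √(n * p)) : 16 * Real.log n ≤ √(n * p) := by
  have := Real.log_natCast_nonneg n
  have hlogq : 0 < Real.log (n * p) := Real.log_pos hq
  have hsqrt : √(n * p) ^ 2 = n * p := Real.sq_sqrt (by linarith)
  have hcube : Real.log n ^ 3 ≤ n * p * Real.log (n * p) ^ 2 := by
    have hsq : graphRate n p ^ 2 ≤ 1 :=
      pow_le_one₀ (by unfold graphRate; positivity) hrate
    rwa [graphRate, mul_pow, Real.sq_sqrt (by positivity), div_pow, div_mul_div_comm,
      div_le_one (by positivity), ← pow_succ'] at hsq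
  refine le_of_pow_le_pow_left₀ three_ne_zero (Real.sqrt_nonneg _) ?_
  calc (16 * Real.log n) ^ 3 = 4096 * Real.log n ^ 3 := by ring
    _ ≤ 4096 * (n * p * Real.log (n * p) ^ 2) := by gcongr
    _ = n * p * (4096 * Real.log (n * p) ^ 2) := by ring
    _ ≤ n * p * √(n * p) := by gcongr
    _ = √(n * p) ^ 3 := by rw [pow_succ, hsqrt]

theorem one_lt_of_log_le_sqrt (hn : 2 ≤ n) (hlog : 16 * Real.log n ≤ √(n * p)) :
    1 < n * p := by
  have hlog2 : Real.log 2 ≤ Real.log n := Real.log_le_log two_pos (by exact_mod_cast hn)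
  exact (Real.lt_sqrt zero_le_one).1 (by linarith [Real.log_two_gt_d9]) |>.trans_eq' (one_pow 2)

theorem log_le_of_log_le_sqrt (hn : 2 ≤ n) (hlog : 16 * Real.log n ≤ √(n * p)) :
    48 * Real.log n ≤ n * p := by
  have hlog2 : Real.log 2 ≤ Real.log n := Real.log_le_log two_pos (by exact_mod_cast hn)
  have hq := one_lt_of_log_le_sqrt hn hlog
  calc 48 * Real.log n ≤ (16 * Real.log n) ^ 2 := by nlinarith [Real.log_two_gt_d9]
    _ ≤ √(n * p) ^ 2 := pow_le_pow_left₀ (by linarith [Real.log_two_gt_d9]) hlog 2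
    _ = n * p := Real.sq_sqrt (by linarith)

/-- An upper level set at least grows by the factor `n * p / (16 * log n)`, which is at least
`√(n * p)`, so that `2 * log n / log (n * p)` steps exhaust half of the subjects. -/
theorem exists_le_pow (hn : 2 ≤ n) (hp : p ≤ 1) (hlog : 16 * Real.log n ≤ √(n * p)) :
    ∃ K : ℕ, n ≤ (n * p / (16 * Real.log n)) ^ K ∧
      K ≤ 3 * (Real.log n / Real.log (n * p)) := by
  have hL : 0 < Real.log n := Real.log_pos (by exact_mod_cast hn)
  have hq := one_lt_of_log_le_sqrt hn hlog
  have hlogq : 0 < Real.log (n * p) := Real.log_pos hq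
  have hsqrt : 0 < √(n * p) := Real.sqrt_pos.2 (by linarith)
  have hfactor : √(n * p) ≤ n * p / (16 * Real.log n) := by
    rw [le_div_iff₀ (by positivity)]
    exact (mul_le_mul_of_nonneg_left hlog hsqrt.le).trans_eq (Real.mul_self_sqrt (by linarith))
  refine ⟨⌈2 * (Real.log n / Real.log (n * p))⌉₊, ?_, ?_⟩
  · refine le_trans ?_ (pow_le_pow_left₀ hsqrt.le hfactor _)
    rw [← Real.log_le_log_iff (by positivity) (by positivity), Real.log_pow,
      Real.log_sqrt (by linarith)]
    calc Real.log n = 2 * (Real.log n / Real.log (n * p)) * (Real.log (n * p) / 2) := by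
          field_simp
      _ ≤ ⌈2 * (Real.log n / Real.log (n * p))⌉₊ * (Real.log (n * p) / 2) := by
          gcongr
          exact Nat.le_ceil _
  · linarith [Nat.ceil_lt_add_one (by positivity : 0 ≤ 2 * (Real.log n / Real.log (n * p))),
      one_le_log_div_log hq hp]

end Rate

section FiniteSample

variable {Ω : Type*} [MeasurableSpace Ω] {P : Measure Ω} [IsProbabilityMeasure P]
  {ν : Measure ℝ} {A : Set ℝ} {f : ℝ → ℝ → ℝ} {T n : ℕ} {p : ℝ} {u : Fin n → ℝ}
  {N : Pair n → Ω → ℕ} {X : Pair n → Fin T → Ω → ℝ}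

theorem exp_neg_nat_mul_log (hn : 0 < n) (k : ℕ) :
    Real.exp (-(k * Real.log n)) = ((n : ℝ) ^ k)⁻¹ := by
  rw [Real.exp_neg, Real.exp_nat_mul, Real.exp_log (Nat.cast_pos.2 hn)]

namespace IsComparisonData

theorem measure_not_expands_le_inv_sq (hf : IsDensityFamily ν A f)
    (hdata : IsComparisonData P ν A f T p u N X) (hp : p ∈ Set.Icc (0 : ℝ) 1) (hT : 1 ≤ T)
    (hn : 2 ≤ n) (hq : 48 * Real.log n ≤ n * p) :
    P {ω | ¬Expands (count T fun e => N e ω) (n * p / (16 * Real.log n)) (n * p / 8)} ≤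
      ENNReal.ofReal (6 / (n : ℝ) ^ 2) := by
  have hn1 : (1 : ℝ) < n := by exact_mod_cast hn
  have hL : 0 < Real.log n := Real.log_pos hn1
  have hexp : n * Real.exp (n * p / (16 * Real.log n) * Real.log n - n * p / 8) ≤
      ((n : ℝ) ^ 2)⁻¹ := by
    calc n * Real.exp (n * p / (16 * Real.log n) * Real.log n - n * p / 8)
        = n * Real.exp (-(n * p / 16)) := by
          congr 2
          field_simp
          ring
      _ ≤ n * Real.exp (-((3 : ℕ) * Real.log n)) := by
          gcongr
          push_cast
          linarith
      _ = ((n : ℝ) ^ 2)⁻¹ := by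
          rw [exp_neg_nat_mul_log (by omega)]
          field_simp
  refine (hdata.measure_not_expands_le hf hp hT
    (hexp.trans (inv_le_one_of_one_le₀ (one_le_pow₀ hn1.le)))).trans ?_
  rw [div_eq_mul_inv (6 : ℝ)]
  gcongr

theorem measure_not_forall_abs_scoreSum_le (hf : IsDensityFamily ν A f)
    (hconc : StrictlyLogConcave A f) (hdata : IsComparisonData P ν A f T p u N X)
    (hp : p ∈ Set.Icc (0 : ℝ) 1) (hn : 2 ≤ n) {t : ℝ} (ht : 0 < t)
    (hb : ∀ e : Pair n, IsPsi2Bound (outcomeLaw ν A f (u e.1.1 - u e.1.2))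
      (fun x => score f x (u e.1.1 - u e.1.2)) t)
    (hq : Real.log n ≤ n * p) :
    P {ω | ¬∀ i, |scoreSum f (fun e => N e ω) (fun e t => X e t ω) u {i}| ≤
      (T + 3) * t * (√(Real.log n / (n * p)) * (n * p))} ≤ ENNReal.ofReal (2 / (n : ℝ) ^ 2) := by
  have hL : 0 < Real.log n := Real.log_pos (by exact_mod_cast hn)
  have hq0 : 0 < n * p := hL.trans_le hq
  set ρ := √(Real.log n / (n * p))
  have hρ0 : 0 < ρ := Real.sqrt_pos.2 (by positivity)
  have hρsq : ρ ^ 2 = Real.log n / (n * p) := Real.sq_sqrt (by positivity)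
  have hvar : (ρ / t * t) ^ 2 = Real.log n / (n * p) := by rw [div_mul_cancel₀ _ ht.ne', hρsq]
  have hthreshold : (T + 3) * t * (ρ * (n * p)) = (T + 3) * Real.log n / (ρ / t) := by
    have hmul : ρ ^ 2 * (n * p) = Real.log n := by rw [hρsq, div_mul_cancel₀ _ hq0.ne']
    rw [← hmul]
    field_simp
  have hexponent : T * p * ((ρ / t * t) ^ 2 * n) - (T + 3) * Real.log n =
      -((3 : ℕ) * Real.log n) := by
    have hmul : p * (Real.log n / (n * p) * n) = Real.log n := by
      calc p * (Real.log n / (n * p) * n) = Real.log n / (n * p) * (n * p) := by ring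
        _ = Real.log n := div_mul_cancel₀ _ hq0.ne'
    rw [hvar, mul_assoc (T : ℝ), hmul]
    push_cast
    ring
  have htail (i : Fin n) : P {ω | (T + 3) * t * (ρ * (n * p)) <
      |scoreSum f (fun e => N e ω) (fun e t => X e t ω) u {i}|} ≤
        ENNReal.ofReal (2 * ((n : ℝ) ^ 3)⁻¹) := by
    rw [← exp_neg_nat_mul_log (by omega), ← hexponent, hthreshold]
    simp only [div_lt_iff₀' (div_pos hρ0 ht)]
    exact hdata.measure_lt_mul_abs_scoreSum_le hf hconc hp hb
      (hvar.trans_le ((div_le_one hq0).2 hq)) i _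
  simp only [not_forall, not_le, Set.ofPred_exists]
  refine (measure_iUnion_le _).trans ?_
  rw [tsum_fintype]
  refine (Finset.sum_le_sum fun i _ => htail i).trans_eq ?_
  rw [Finset.sum_const, Finset.card_univ, Fintype.card_fin, ← ENNReal.ofReal_nsmul, nsmul_eq_mul]
  congr 1
  field_simp

theorem measure_not_isUniqueMLE_le (hf : IsDensityFamily ν A f) (hconc : StrictlyLogConcave A f)
    (hdata : IsComparisonData P ν A f T p u N X) (hp : p ∈ Set.Icc (0 : ℝ) 1) (hT : 1 ≤ T)
    (hn : 2 ≤ n) (hu : u ∈ paramSpace n) {c4 : ℝ} (hc4 : 0 < c4)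
    (hcurv : ∀ x ∈ A, ∀ y, |y| ≤ dynamicRange u + 1 → c4 ≤ |scoreDeriv f x y|)
    {c5 : ℝ≥0} (hc5 : 0 < c5) (hsubG : ∀ y : ℝ, |y| ≤ dynamicRange u →
      psi2Norm (outcomeLaw ν A f y) (fun x => score f x y) ≤ c5)
    (hlog : 16 * Real.log n ≤ √(n * p))
    (hsmall : 96 * (T + 3) * (c5 / c4 * graphRate n p) < 1) :
    P {ω | ¬∃ v, IsUniqueMLE f (fun e => N e ω) (fun e t => X e t ω) v ∧
      ‖v - u‖ ≤ 96 * (T + 3) * (c5 / c4 * graphRate n p)} ≤ ENNReal.ofReal (8 / (n : ℝ) ^ 2) := by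
  have hL : 0 < Real.log n := Real.log_pos (by exact_mod_cast hn)
  have hq := log_le_of_log_le_sqrt hn hlog
  have hq0 : 0 < n * p := by linarith
  obtain ⟨K, hKpow, hK⟩ := exists_le_pow hn hp.2 hlog
  set R := n * p / (16 * Real.log n)
  have hR1 : 1 ≤ R := (one_le_div (by positivity)).2 (by linarith)
  set δ := 16 * (T + 3) * (c5 / c4) * √(Real.log n / (n * p)) with hδ
  have hδ0 : 0 < δ := by positivity
  have hnoise : (T + 3) * (2 * c5) * (√(Real.log n / (n * p)) * (n * p)) =
      c4 * (δ * (n * p / 8)) := by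
    rw [hδ]
    field_simp
    ring
  have hbound : 2 * (K * δ) ≤ 96 * (T + 3) * (c5 / c4 * graphRate n p) := by
    calc 2 * (K * δ) ≤ 2 * (3 * (Real.log n / Real.log (n * p)) * δ) := by gcongr
      _ = 96 * (T + 3) * (c5 / c4 * graphRate n p) := by
        rw [hδ, graphRate]
        ring
  have hpsi2 (e : Pair n) : IsPsi2Bound (outcomeLaw ν A f (u e.1.1 - u e.1.2))
      (fun x => score f x (u e.1.1 - u e.1.2)) (2 * c5) := by
    refine .of_psi2Norm_lt ((hsubG _ (abs_sub_le_dynamicRange u _ _)).trans_lt ?_)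
    rw [← ENNReal.ofReal_coe_nnreal, ENNReal.ofReal_lt_ofReal_iff (by positivity)]
    exact lt_two_mul_self (by exact_mod_cast hc5)
  calc _ ≤ P ({ω | ¬Expands (count T fun e => N e ω) R (n * p / 8)} ∪
        {ω | ¬∀ i, |scoreSum f (fun e => N e ω) (fun e t => X e t ω) u {i}| ≤
          (T + 3) * (2 * c5) * (√(Real.log n / (n * p)) * (n * p))}) := by
        refine measure_mono_ae ?_
        filter_upwards [hdata.ae_forall_outcome fun e => hf.ae_mem _] with ω hX hω
        by_contra hgood
        obtain ⟨hexp, hscore⟩ := not_or.1 hgood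
        obtain ⟨v, hv, hvu⟩ := exists_isUniqueMLE_of_expands hconc hX hu (by omega) hc4 hcurv
          (not_not.1 hexp) hR1 (by positivity) hδ0 (hnoise ▸ not_not.1 hscore) hKpow
          (hbound.trans_lt hsmall)
        exact hω ⟨v, hv, hvu.trans hbound⟩
    _ ≤ ENNReal.ofReal (6 / (n : ℝ) ^ 2) + ENNReal.ofReal (2 / (n : ℝ) ^ 2) :=
        (measure_union_le _ _).trans (add_le_add
          (hdata.measure_not_expands_le_inv_sq hf hp hT hn hq)
          (hdata.measure_not_forall_abs_scoreSum_le hf hconc hp hn (by positivity) hpsi2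
            (by linarith)))
    _ = ENNReal.ofReal (8 / (n : ℝ) ^ 2) := by
        rw [← ENNReal.ofReal_add (by positivity) (by positivity), ← add_div]
        norm_num

end IsComparisonData

end FiniteSample

section Curvature

variable {A : Set ℝ} {f : ℝ → ℝ → ℝ} {M M' : ℝ} {c5 : ℝ≥0} {n : ℕ} {p : ℝ}

theorem toReal_C4_le {x y : ℝ} (hx : x ∈ A) (hy : |y| ≤ M + 1) :
    (C4 A f M).toReal ≤ |scoreDeriv f x y| :=
  ENNReal.toReal_le_of_le_ofReal (abs_nonneg _) (iInf₂_le_of_le x hx (iInf₂_le_of_le y hy le_rfl))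

theorem C4_anti (h : M ≤ M') : C4 A f M' ≤ C4 A f M :=
  iInf₂_mono fun _ _ => iInf_mono fun _ => iInf_mono' fun hy => ⟨by linarith, le_rfl⟩

theorem C4_ne_top (hA : A.Nonempty) (hM : 0 ≤ M) : C4 A f M ≠ ∞ := by
  obtain ⟨x, hx⟩ := hA
  refine ne_top_of_le_ne_top (ENNReal.ofReal_ne_top (r := |scoreDeriv f x 0|)) ?_
  exact iInf₂_le_of_le x hx (iInf₂_le_of_le 0 (by rw [abs_zero]; linarith) le_rfl)

theorem ofReal_abs_scoreDeriv_le_C3 {x y : ℝ} (hx : x ∈ A) (hy : |y| ≤ M + 1) :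
    ENNReal.ofReal |scoreDeriv f x y| ≤ C3 A f M :=
  le_iSup₂_of_le (f := fun x _ => ⨆ (y : ℝ) (_ : |y| ≤ M + 1), ENNReal.ofReal |scoreDeriv f x y|)
    x hx (le_iSup₂_of_le (f := fun y _ => ENNReal.ofReal |scoreDeriv f x y|) y hy le_rfl)

theorem C4_le_C3 (hA : A.Nonempty) (hM : 0 ≤ M) : C4 A f M ≤ C3 A f M := by
  obtain ⟨x, hx⟩ := hA
  have hzero : |(0 : ℝ)| ≤ M + 1 := by rw [abs_zero]; linarith
  exact (iInf₂_le_of_le x hx (iInf₂_le_of_le 0 hzero le_rfl)).trans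
    (ofReal_abs_scoreDeriv_le_C3 hx hzero)

theorem C3_ne_zero (hA : A.Nonempty) (hconc : StrictlyLogConcave A f) (hM : 0 ≤ M) :
    C3 A f M ≠ 0 := by
  obtain ⟨x, hx⟩ := hA
  have hpos : 0 < ENNReal.ofReal |scoreDeriv f x 0| :=
    ENNReal.ofReal_pos.2 (abs_pos.2 (hconc.scoreDeriv_neg x hx 0).ne)
  exact (hpos.trans_le (ofReal_abs_scoreDeriv_le_C3 hx (by rw [abs_zero]; linarith))).ne'

theorem div_mul_le_Delta (hA : A.Nonempty) (hconc : StrictlyLogConcave A f) (hM : 0 ≤ M)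
    (hc5 : c5 ≠ 0) :
    c5 / C4 A f M * ENNReal.ofReal (graphRate n p) ≤ Delta A f n M p c5 := by
  suffices h : (c5 : ℝ≥0∞) / C4 A f M ≤ C3 A f M * c5 / C4 A f M ^ 2 from
    mul_le_mul_left h (ENNReal.ofReal (graphRate n p))
  by_cases hC4 : C4 A f M = 0
  · rw [hC4, zero_pow two_ne_zero,
      ENNReal.div_zero (mul_ne_zero (C3_ne_zero hA hconc hM) (ENNReal.coe_ne_zero.2 hc5))]
    exact le_top
  · calc (c5 : ℝ≥0∞) / C4 A f M = C4 A f M * c5 / C4 A f M ^ 2 := by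
          rw [pow_two, ENNReal.mul_div_mul_left _ _ hC4 (C4_ne_top hA hM)]
      _ ≤ C3 A f M * c5 / C4 A f M ^ 2 := by
          gcongr
          exact C4_le_C3 hA hM

theorem C4_ne_zero_of_Delta_ne_top (hA : A.Nonempty) (hconc : StrictlyLogConcave A f)
    (hM : 0 ≤ M) (hc5 : c5 ≠ 0) (hrate : 0 < graphRate n p) (hDelta : Delta A f n M p c5 ≠ ∞) :
    C4 A f M ≠ 0 := by
  intro hC4
  have hle := div_mul_le_Delta hA hconc hM hc5 (n := n) (p := p)
  rw [hC4, ENNReal.div_zero (ENNReal.coe_ne_zero.2 hc5),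
    ENNReal.top_mul (ENNReal.ofReal_pos.2 hrate).ne', top_le_iff] at hle
  exact hDelta hle

theorem ofReal_div_mul_graphRate_le_Delta (hA : A.Nonempty) (hconc : StrictlyLogConcave A f)
    (hM : 0 ≤ M) (hc5 : c5 ≠ 0) (hC4 : C4 A f M ≠ 0) :
    ENNReal.ofReal (c5 / (C4 A f M).toReal * graphRate n p) ≤ Delta A f n M p c5 := by
  have htop := C4_ne_top (f := f) hA hM
  refine (div_mul_le_Delta hA hconc hM hc5).trans_eq' ?_
  rw [ENNReal.ofReal_mul (by positivity), ENNReal.ofReal_div_of_pos (ENNReal.toReal_pos hC4 htop),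
    ENNReal.ofReal_coe_nnreal, ENNReal.ofReal_toReal htop]

end Curvature

section Probability

variable {Ω : Type*} [MeasurableSpace Ω] {P : Measure Ω}

theorem exists_measurableSet_of_measure_not_le [IsProbabilityMeasure P] {good : Ω → Prop} {ε : ℝ}
    (hε : 0 ≤ ε) (h : P {ω | ¬good ω} ≤ ENNReal.ofReal ε) :
    ∃ E, MeasurableSet E ∧ 1 - ε ≤ P.real E ∧ ∀ ω ∈ E, good ω := by
  have hmeas := measurableSet_toMeasurable P {ω | ¬good ω}
  refine ⟨(toMeasurable P {ω | ¬good ω})ᶜ, hmeas.compl, ?_, fun ω hω => ?_⟩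
  · rw [probReal_compl_eq_one_sub hmeas, Measure.real, measure_toMeasurable]
    exact sub_le_sub_left (ENNReal.toReal_le_of_le_ofReal hε h) 1
  · exact not_not.1 fun hbad => hω (subset_toMeasurable P _ hbad)

theorem ae_eventually_of_measure_not_le {good : ℕ → Ω → Prop} {ε : ℕ → ℝ} (hε : Summable ε)
    (h : ∀ᶠ n in atTop, P {ω | ¬good n ω} ≤ ENNReal.ofReal (ε n)) :
    ∀ᵐ ω ∂P, ∀ᶠ n in atTop, good n ω := by
  obtain ⟨n₀, hn₀⟩ := eventually_atTop.1 h
  have hsum : ∑' k, P {ω | ¬good (k + n₀) ω} ≠ ∞ :=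
    ne_top_of_le_ne_top ((summable_nat_add_iff n₀).2 hε).tsum_ofReal_ne_top
      (ENNReal.tsum_le_tsum fun k => hn₀ (k + n₀) (Nat.le_add_left _ _))
  filter_upwards [ae_eventually_notMem hsum] with ω hω
  rw [← map_add_atTop_eq_nat n₀, eventually_map]
  exact hω.mono fun k hk => not_not.1 hk

end Probability

section Asymptotics

variable {Ω : Type*} [MeasurableSpace Ω] {P : Measure Ω} [IsProbabilityMeasure P]
  {ν : Measure ℝ} {A : Set ℝ} {f : ℝ → ℝ → ℝ} {T : ℕ}

theorem IsComparisonData.measure_not_isUniqueMLE_le_of_Delta {n : ℕ} {p : ℝ} {u : Fin n → ℝ}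
    {N : Pair n → Ω → ℕ} {X : Pair n → Fin T → Ω → ℝ} {c5 : ℝ≥0} (hf : IsDensityFamily ν A f)
    (hconc : StrictlyLogConcave A f) (hdata : IsComparisonData P ν A f T p u N X)
    (hp : p ∈ Set.Icc (0 : ℝ) 1) (hT : 1 ≤ T) (hn : 2 ≤ n) (hu : u ∈ paramSpace n)
    (hsubG : ∀ y : ℝ, |y| ≤ dynamicRange u →
      psi2Norm (outcomeLaw ν A f y) (fun x => score f x y) ≤ c5)
    (hlog : 16 * Real.log n ≤ √(n * p))
    (hsmall : ENNReal.ofReal (96 * (T + 3)) * Delta A f n (dynamicRange u) p c5 < 1) :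
    P {ω | ¬∃ v, IsUniqueMLE f (fun e => N e ω) (fun e t => X e t ω) v ∧
      ENNReal.ofReal ‖v - u‖ ≤
        ENNReal.ofReal (96 * (T + 3)) * Delta A f n (dynamicRange u) p c5} ≤
      ENNReal.ofReal (8 / (n : ℝ) ^ 2) := by
  have hM := dynamicRange_nonneg u
  have hc5 : c5 ≠ 0 := by
    rintro rfl
    exact hf.psi2Norm_score_ne_zero hconc 0 (nonpos_iff_eq_zero.1 (hsubG 0 (by simpa using hM)))
  have hDelta : Delta A f n (dynamicRange u) p c5 ≠ ∞ := by
    intro htop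
    rw [htop, ENNReal.mul_top (ENNReal.ofReal_pos.2 (by positivity)).ne'] at hsmall
    exact not_top_lt hsmall
  have hC4 := C4_ne_zero_of_Delta_ne_top hf.nonempty hconc hM hc5
    (graphRate_pos hn (one_lt_of_log_le_sqrt hn hlog)) hDelta
  have hbound : ENNReal.ofReal
      (96 * (T + 3) * (c5 / (C4 A f (dynamicRange u)).toReal * graphRate n p)) ≤
        ENNReal.ofReal (96 * (T + 3)) * Delta A f n (dynamicRange u) p c5 := by
    rw [ENNReal.ofReal_mul (by positivity)]
    gcongr
    exact ofReal_div_mul_graphRate_le_Delta hf.nonempty hconc hM hc5 hC4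
  refine (measure_mono fun ω hω => ?_).trans (hdata.measure_not_isUniqueMLE_le hf hconc hp hT hn hu
    (ENNReal.toReal_pos hC4 (C4_ne_top hf.nonempty hM)) (fun x hx y hy => toReal_C4_le hx hy)
    (pos_iff_ne_zero.2 hc5) hsubG hlog (ENNReal.ofReal_lt_one.1 (hbound.trans_lt hsmall)))
  rintro ⟨v, hv, hvu⟩
  exact hω ⟨v, hv, (ENNReal.ofReal_le_ofReal hvu).trans hbound⟩

variable {p : ℕ → ℝ} {u : (n : ℕ) → Fin n → ℝ} {c5 : ℕ → ℝ≥0}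

/-- The sub-Gaussian constants are bounded away from `0` by the `ψ₂`-norm of the score at `0`, and
the curvature constants are bounded above. -/
theorem tendsto_ofReal_graphRate (hf : IsDensityFamily ν A f) (hconc : StrictlyLogConcave A f)
    (hsubG : ∀ n, ∀ y : ℝ, |y| ≤ dynamicRange (u n) →
      psi2Norm (outcomeLaw ν A f y) (fun x => score f x y) ≤ c5 n)
    (hDelta : Tendsto (fun n => Delta A f n (dynamicRange (u n)) (p n) (c5 n)) atTop (𝓝 0)) :
    Tendsto (fun n => ENNReal.ofReal (graphRate n (p n))) atTop (𝓝 0) := by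
  set ψ := psi2Norm (outcomeLaw ν A f 0) (fun x => score f x 0)
  have hψ0 : ψ ≠ 0 := hf.psi2Norm_score_ne_zero hconc 0
  have hψ_le (n : ℕ) : ψ ≤ c5 n := hsubG n 0 (by simpa using dynamicRange_nonneg (u n))
  -- The minimum keeps the constant finite: `C4 A f 0` may vanish.
  set a : ℝ≥0∞ := min 1 (ψ / C4 A f 0)
  have ha0 : a ≠ 0 := (lt_min one_pos
    (pos_iff_ne_zero.2 (ENNReal.div_ne_zero.2 ⟨hψ0, C4_ne_top hf.nonempty le_rfl⟩))).ne'
  have ha_top : a ≠ ∞ := ne_top_of_le_ne_top ENNReal.one_ne_top (min_le_left _ _)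
  have hle (n : ℕ) : ENNReal.ofReal (graphRate n (p n)) ≤
      Delta A f n (dynamicRange (u n)) (p n) (c5 n) / a := by
    have hM := dynamicRange_nonneg (u n)
    have hc5 : c5 n ≠ 0 := fun h => hψ0 (by simpa [h] using hψ_le n)
    rw [ENNReal.le_div_iff_mul_le (Or.inl ha0) (Or.inl ha_top), mul_comm]
    refine le_trans ?_ (div_mul_le_Delta hf.nonempty hconc hM hc5)
    gcongr
    exact (min_le_right _ _).trans (ENNReal.div_le_div (hψ_le n) (C4_anti hM))
  refine tendsto_of_tendsto_of_tendsto_of_le_of_le tendsto_const_nhds ?_ (fun _ => zero_le) hle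
  simpa using ENNReal.Tendsto.div_const hDelta (b := a) (Or.inr ha0)

theorem eventually_log_le_sqrt (hp : ∀ n, p n ≤ 1) (hq : ∀ᶠ n : ℕ in atTop, 1 < n * p n)
    (hrate : ∀ᶠ n : ℕ in atTop, graphRate n (p n) ≤ 1) :
    ∀ᶠ n : ℕ in atTop, 16 * Real.log n ≤ √(n * p n) := by
  have htop : Tendsto (fun n : ℕ => n * p n) atTop atTop := by
    refine tendsto_atTop_mono' atTop ?_ (Real.tendsto_log_atTop.comp tendsto_natCast_atTop_atTop)
    filter_upwards [hq, hrate] with n hq hrate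
    have hsqrt : √(Real.log n / (n * p n)) ≤ 1 :=
      (sqrt_log_div_le_graphRate hq (hp n)).trans hrate
    exact (div_le_one (by linarith)).1 (Real.sqrt_le_one.1 hsqrt)
  filter_upwards [hq, hrate, htop.eventually eventually_log_sq_le] with n hq hrate hlog
  exact log_le_sqrt_of_graphRate_le_one hq hrate hlog

theorem eventually_one_lt_mul
    (hp_lower : ∃ c : ℝ, 1 < c ∧ ∀ᶠ n : ℕ in atTop, c * (Real.log n / n) ≤ p n) :
    ∀ᶠ n : ℕ in atTop, 1 < n * p n := by
  obtain ⟨c, hc, hpn⟩ := hp_lower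
  filter_upwards [hpn, (Real.tendsto_log_atTop.comp tendsto_natCast_atTop_atTop).eventually_gt_atTop
    (1 : ℝ), eventually_gt_atTop 0] with n hpn hlog hn
  have : (0 : ℝ) < n := by exact_mod_cast hn
  calc 1 < Real.log n := hlog
    _ ≤ c * Real.log n := le_mul_of_one_le_left (zero_le_one.trans hlog.le) hc.le
    _ = n * (c * (Real.log n / n)) := by field_simp
    _ ≤ n * p n := by gcongr

theorem tendsto_const_mul_Delta {C : ℝ≥0∞} (hC : C ≠ ∞)
    (hDelta : Tendsto (fun n => Delta A f n (dynamicRange (u n)) (p n) (c5 n)) atTop (𝓝 0)) :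
    Tendsto (fun n => C * Delta A f n (dynamicRange (u n)) (p n) (c5 n)) atTop (𝓝 0) := by
  simpa using ENNReal.Tendsto.const_mul hDelta (Or.inr hC)

theorem eventually_measure_not_isUniqueMLE_le
    {N : (n : ℕ) → Pair n → Ω → ℕ} {X : (n : ℕ) → Pair n → Fin T → Ω → ℝ}
    (hf : IsDensityFamily ν A f)
    (hconc : StrictlyLogConcave A f) (hT : 1 ≤ T) (hp : ∀ n, p n ∈ Set.Icc (0 : ℝ) 1)
    (hq : ∀ᶠ n : ℕ in atTop, 1 < n * p n) (hu : ∀ n, u n ∈ paramSpace n)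
    (hdata : ∀ n, IsComparisonData P ν A f T (p n) (u n) (N n) (X n))
    (hsubG : ∀ n, ∀ y : ℝ, |y| ≤ dynamicRange (u n) →
      psi2Norm (outcomeLaw ν A f y) (fun x => score f x y) ≤ c5 n)
    (hDelta : Tendsto (fun n => Delta A f n (dynamicRange (u n)) (p n) (c5 n)) atTop (𝓝 0)) :
    ∀ᶠ n : ℕ in atTop, P {ω | ¬∃ v : Fin n → ℝ,
        IsUniqueMLE f (fun e => N n e ω) (fun e t => X n e t ω) v ∧
        ENNReal.ofReal ‖v - u n‖ ≤ ENNReal.ofReal (96 * (T + 3)) *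
          Delta A f n (dynamicRange (u n)) (p n) (c5 n)} ≤
      ENNReal.ofReal (8 / (n : ℝ) ^ 2) := by
  have hrate : ∀ᶠ n : ℕ in atTop, graphRate n (p n) ≤ 1 :=
    ((tendsto_ofReal_graphRate hf hconc hsubG hDelta).eventually_le_const one_pos).mono
      fun n hn => ENNReal.ofReal_le_one.1 hn
  filter_upwards [eventually_log_le_sqrt (fun n => (hp n).2) hq hrate, eventually_ge_atTop 2,
    (tendsto_const_mul_Delta ENNReal.ofReal_ne_top hDelta).eventually_lt_const one_pos]
    with n hlog hn hsmall
  exact (hdata n).measure_not_isUniqueMLE_le_of_Delta hf hconc (hp n) hT hn (hu n) (hsubG n) hlog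
    hsmall

theorem tendsto_norm_of_eventually_ofReal_le {E : ℕ → Type*} [∀ n, SeminormedAddCommGroup (E n)]
    {w : (n : ℕ) → E n} {r : ℕ → ℝ≥0∞} (hr : Tendsto r atTop (𝓝 0))
    (hw : ∀ᶠ n in atTop, ENNReal.ofReal ‖w n‖ ≤ r n) :
    Tendsto (fun n => ‖w n‖) atTop (𝓝 0) := by
  have hlim : Tendsto (fun n => ENNReal.ofReal ‖w n‖) atTop (𝓝 0) :=
    tendsto_of_tendsto_of_tendsto_of_le_of_le' tendsto_const_nhds hr
      (Eventually.of_forall fun _ => zero_le) hw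
  simpa [Function.comp_def, ENNReal.toReal_ofReal] using
    (ENNReal.tendsto_toReal ENNReal.zero_ne_top).comp hlim

end Asymptotics

end PairwiseComparison

end

theorem mainTheorem2_general
    {Ω : Type*} [MeasurableSpace Ω] (P : Measure Ω) [IsProbabilityMeasure P]
    (ν : Measure ℝ) (A : Set ℝ) (f : ℝ → ℝ → ℝ)
    (hf : IsDensityFamily ν A f) (hconc : StrictlyLogConcave A f)
    (T : ℕ) (hT : 1 ≤ T)
    (p : ℕ → ℝ) (hp : ∀ n, p n ∈ Set.Icc (0 : ℝ) 1)
    (hq : ∀ᶠ n : ℕ in atTop, 1 < n * p n)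
    (u : (n : ℕ) → Fin n → ℝ) (hu : ∀ n, u n ∈ paramSpace n)
    (N : (n : ℕ) → Pair n → Ω → ℕ) (X : (n : ℕ) → Pair n → Fin T → Ω → ℝ)
    (hdata : ∀ n, IsComparisonData P ν A f T (p n) (u n) (N n) (X n))
    (c5 : ℕ → ℝ≥0)
    (hsubG : ∀ n, ∀ y : ℝ, |y| ≤ dynamicRange (u n) →
      psi2Norm (outcomeLaw ν A f y) (fun x => score f x y) ≤ c5 n)
    (hDelta : Tendsto (fun n => Delta A f n (dynamicRange (u n)) (p n) (c5 n)) atTop (𝓝 0)) :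
    (∃ K : ℝ≥0, ∀ᶠ n : ℕ in atTop,
      ∃ E : Set Ω, MeasurableSet E ∧ 1 - 14 / (n : ℝ) ^ 2 ≤ P.real E ∧
        ∀ ω ∈ E, ∃ v : Fin n → ℝ,
          IsUniqueMLE f (fun e => N n e ω) (fun e t => X n e t ω) v ∧
          ENNReal.ofReal ‖v - u n‖ ≤ K * Delta A f n (dynamicRange (u n)) (p n) (c5 n)) ∧
    (∀ᵐ ω ∂P, ∃ v : (n : ℕ) → Fin n → ℝ,
      (∀ᶠ n in atTop, IsUniqueMLE f (fun e => N n e ω) (fun e t => X n e t ω) (v n)) ∧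
      Tendsto (fun n => ‖v n - u n‖) atTop (𝓝 0)) := by
  have hbad := eventually_measure_not_isUniqueMLE_le hf hconc hT hp hq hu hdata hsubG hDelta
  have hsummable : Summable fun n : ℕ => 8 / (n : ℝ) ^ 2 := by
    simpa only [div_eq_mul_inv] using (Real.summable_nat_pow_inv.2 one_lt_two).mul_left 8
  refine ⟨⟨Real.toNNReal (96 * (T + 3)), ?_⟩, ?_⟩
  · exact hbad.mono fun n hn => exists_measurableSet_of_measure_not_le (by positivity)
      (hn.trans (ENNReal.ofReal_le_ofReal (by gcongr; norm_num)))
  · filter_upwards [ae_eventually_of_measure_not_le hsummable hbad] with ω hω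
    obtain ⟨v, hv⟩ := skolem.1 hω
    exact ⟨v, hv.mono fun n hn => hn.1, tendsto_norm_of_eventually_ofReal_le
      (tendsto_const_mul_Delta ENNReal.ofReal_ne_top hDelta) (hv.mono fun n hn => hn.2)⟩

theorem mainTheorem2
    {Ω : Type*} [MeasurableSpace Ω] (P : Measure Ω) [IsProbabilityMeasure P]
    (ν : Measure ℝ) (A : Set ℝ) (f : ℝ → ℝ → ℝ)
    (hf : IsValid ν A f) (hconc : StrictlyLogConcave A f)
    (T : ℕ) (hT : 1 ≤ T)
    (p : ℕ → ℝ) (hp : ∀ n, p n ∈ Set.Icc (0 : ℝ) 1)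
    (hp_lower : ∃ c : ℝ, 1 < c ∧ ∀ᶠ n : ℕ in atTop, c * (Real.log n / n) ≤ p n)
    (u : (n : ℕ) → Fin n → ℝ) (hu : ∀ n, u n ∈ paramSpace n)
    (N : (n : ℕ) → Pair n → Ω → ℕ) (X : (n : ℕ) → Pair n → Fin T → Ω → ℝ)
    (hdata : ∀ n, IsComparisonData P ν A f T (p n) (u n) (N n) (X n))
    (c5 : ℕ → ℝ≥0)
    (hsubG : ∀ n, ∀ y : ℝ, |y| ≤ dynamicRange (u n) →
      psi2Norm (outcomeLaw ν A f y) (fun x => score f x y) ≤ c5 n)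
    (hDelta : Tendsto (fun n => Delta A f n (dynamicRange (u n)) (p n) (c5 n)) atTop (𝓝 0))
    (hexist : Tendsto (fun n : ℕ =>
      Real.log n / (n * p n * |Real.log (C1 ν A f (dynamicRange (u n)))|)) atTop (𝓝 0)) :
    (∃ K : ℝ≥0, ∀ᶠ n : ℕ in atTop,
      ∃ E : Set Ω, MeasurableSet E ∧ 1 - 14 / (n : ℝ) ^ 2 ≤ P.real E ∧
        ∀ ω ∈ E, ∃ v : Fin n → ℝ,
          IsUniqueMLE f (fun e => N n e ω) (fun e t => X n e t ω) v ∧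
          ENNReal.ofReal ‖v - u n‖ ≤ K * Delta A f n (dynamicRange (u n)) (p n) (c5 n)) ∧
    (∀ᵐ ω ∂P, ∃ v : (n : ℕ) → Fin n → ℝ,
      (∀ᶠ n in atTop, IsUniqueMLE f (fun e => N n e ω) (fun e t => X n e t ω) (v n)) ∧
      Tendsto (fun n => ‖v n - u n‖) atTop (𝓝 0)) := by
  exact mainTheorem2_general P ν A f hf.isDensityFamily hconc T hT p hp
    (eventually_one_lt_mul hp_lower) u hu N X hdata c5 hsubG hDelta
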